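/- **Theorem 8.13.** Let $v_0,v_1,v_2\in\mathbb R^2$ be the lower right, top and lower left vertex of an equilateral triangle with side length $2\pi/3$ and a horizontal bottom edge, and let $F_j(x)=(x+v_j)/2$. For a word $w=w_1\cdots w_n\in\{0,1,2\}^n$, $n\ge 0$, put $F_w=F_{w_1}\circ\dots\circ F_{w_n}$, and let $\Delta_w$ be the union of the three sides of the triangle with vertices $F_w(v_0),F_w(v_1),F_w(v_2)$; its perimeter is $2^{1-n}\pi$. The Sierpinski gasket is $$\mathcal{SG}=\overline{\bigcup_{n\ge0}\ \bigcup_{w\in\{0,1,2\}^n}\Delta_w}\subset\mathbb R^2 .$$ Let $r_w:\mathbb R/2^{1-n}\pi\mathbb Z\to\Delta_w$ be the parameterization by arclength, run counterclockwise, with $r_w(0)=F_w(v_0)$. For a word $w$ of length $n$, let $H_w=L^2(\mathbb R/2^{1-n}\pi\mathbb Z)$ with respect to normalized Lebesgue measure, with orthonormal basis $\phi_k(x)=e^{i2^nkx}$, $k\in\mathbb Z$. Let $D_w$ be the self-adjoint operator on $H_w$ with $D_w\phi_k=2^n(k+\tfrac12)\phi_k$, whose domain consists of all $\xi$ with $\sum_k|2^n(k+\tfrac12)|^2|\langle\xi,\phi_k\rangle|^2<\infty$.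 For a continuous function $f:\mathcal{SG}\to\mathbb C$, let $\pi_w(f)$ be multiplication by $f\circ r_w$ on $H_w$. The spectral triple $ST(\mathcal{SG})=(C(\mathcal{SG}),H_{\mathcal{SG}},D_{\mathcal{SG}})$ is the direct sum over all words $w$ of all lengths $n\ge0$: $$H_{\mathcal{SG}}=\bigoplus_wH_w,\qquad D_{\mathcal{SG}}=\bigoplus_wD_w,\qquad \pi(f)=\bigoplus_w\pi_w(f),$$ where $\operatorname{dom}D_{\mathcal{SG}}$ consists of all $\xi=(\xi_w)_w\in H_{\mathcal{SG}}$ with $\xi_w\in\operatorname{dom}D_w$ for all $w$ and $\sum_w\|D_w\xi_w\|^2<\infty$. For $f\in C(\mathcal{SG})$, write $\|[D_{\mathcal{SG}},\pi(f)]\|\le1$ if $\pi(f)$ maps $\operatorname{dom}D_{\mathcal{SG}}$ into itself and $\|D_{\mathcal{SG}}\pi(f)\xi-\pi(f)D_{\mathcal{SG}}\xi\|\le\|\xi\|$ for all $\xi\in\operatorname{dom}D_{\mathcal{SG}}$. For $p,q\in\mathcal{SG}$ let $$d_{\mathcal{SG}}(p,q)=\sup\{\,|f(p)-f(q)| \;:\;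 f\in C(\mathcal{SG}),\ \|[D_{\mathcal{SG}},\pi(f)]\|\le1\,\},$$ and let $d_{geo}(p,q)$ be the infimum of the lengths of the rectifiable continuous curves in $\mathcal{SG}$ from $p$ to $q$. Then, for all $p,q\in\mathcal{SG}$, $$d_{\mathcal{SG}}(p,q)=d_{geo}(p,q)<\infty .$$ -/

import Mathlib

open MeasureTheory Set
open scoped ENNReal NNReal unitInterval

noncomputable section

namespace SierpinskiGasket

/-! ### Direct sums of operators on Hilbert spaces -/

section Diagonal

variable {ι E : Type*} [NormedAddCommGroup E] [InnerProductSpace ℂ E]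

/-- All `x` with `∑ |lam i|² |⟨b i, x⟩|² < ∞`. -/
def diagonalDomain (b : HilbertBasis ι ℂ E) (lam : ι → ℝ) : Submodule ℂ E where
  carrier := {x | Memℓp (fun i => (lam i : ℂ) * b.repr x i) 2}
  zero_mem' := by
    have h : (fun i => (lam i : ℂ) * b.repr (0 : E) i) = 0 := by ext i; simp
    change Memℓp (fun i => (lam i : ℂ) * b.repr (0 : E) i) 2
    rw [h]
    exact zero_memℓp
  add_mem' := by
    intro x y hx hy
    have h : (fun i => (lam i : ℂ) * b.repr (x + y) i) =
        (fun i => (lam i : ℂ) * b.repr x i) + fun i => (lam i : ℂ) * b.repr y i := by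
      ext i
      simp [mul_add]
    change Memℓp (fun i => (lam i : ℂ) * b.repr (x + y) i) 2
    rw [h]
    exact Memℓp.add hx hy
  smul_mem' := by
    intro c x hx
    have h : (fun i => (lam i : ℂ) * b.repr (c • x) i) =
        c • fun i => (lam i : ℂ) * b.repr x i := by
      ext i
      simp [mul_left_comm]
    change Memℓp (fun i => (lam i : ℂ) * b.repr (c • x) i) 2
    rw [h]
    exact Memℓp.const_smul hx c

/-- The self-adjoint diagonal operator with real eigenvalues `lam i` along a Hilbert basis `b`:
it maps `x` to `∑ lam i ⟨b i, x⟩ b i`, on the domain where this series converges. -/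
def diagonalOperator (b : HilbertBasis ι ℂ E) (lam : ι → ℝ) : E →ₗ.[ℂ] E where
  domain := diagonalDomain b lam
  toFun :=
    { toFun := fun x => b.repr.symm ⟨fun i => (lam i : ℂ) * b.repr (x : E) i, x.2⟩
      map_add' := by
        intro x y
        apply b.repr.injective
        rw [map_add]
        simp only [LinearIsometryEquiv.apply_symm_apply]
        ext i
        change (lam i : ℂ) * b.repr ((x : E) + y) i = _
        rw [map_add]
        exact mul_add _ _ _
      map_smul' := by
        intro c x
        apply b.repr.injective
        rw [RingHom.id_apply, map_smul]
        simp only [LinearIsometryEquiv.apply_symm_apply]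
        ext i
        change (lam i : ℂ) * b.repr (c • (x : E)) i = _
        rw [map_smul]
        exact mul_left_comm _ _ _ }

end Diagonal

section DirectSum

variable {ι : Type*} {E : ι → Type*} [∀ i, NormedAddCommGroup (E i)]
  [∀ i, InnerProductSpace ℂ (E i)]

/-- The Hilbert space direct sum of a family of unbounded operators: `ξ` is in the domain when
every component `ξ i` is in the domain of `D i` and `∑ ‖D i (ξ i)‖² < ∞`. -/
def directSumOperator (D : ∀ i, E i →ₗ.[ℂ] E i) : lp E 2 →ₗ.[ℂ] lp E 2 where
  domain :=
    { carrier := {ξ | ∃ h : ∀ i, ξ i ∈ (D i).domain, Memℓp (fun i => D i ⟨ξ i, h i⟩) 2}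
      zero_mem' := by
        refine ⟨fun i => (D i).domain.zero_mem, ?_⟩
        have h : (fun i => D i ⟨(0 : lp E 2) i, (D i).domain.zero_mem⟩) = 0 := by
          ext i
          exact (D i).map_zero
        rw [h]
        exact zero_memℓp
      add_mem' := by
        rintro x y ⟨hx, hx'⟩ ⟨hy, hy'⟩
        refine ⟨fun i => (D i).domain.add_mem (hx i) (hy i), ?_⟩
        have h : (fun i => D i ⟨(x + y) i, (D i).domain.add_mem (hx i) (hy i)⟩) =
            (fun i => D i ⟨x i, hx i⟩) + fun i => D i ⟨y i, hy i⟩ := by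
          ext i
          exact (D i).map_add ⟨x i, hx i⟩ ⟨y i, hy i⟩
        rw [h]
        exact hx'.add hy'
      smul_mem' := by
        rintro c x ⟨hx, hx'⟩
        refine ⟨fun i => (D i).domain.smul_mem c (hx i), ?_⟩
        have h : (fun i => D i ⟨(c • x) i, (D i).domain.smul_mem c (hx i)⟩) =
            c • fun i => D i ⟨x i, hx i⟩ := by
          ext i
          exact (D i).map_smul c ⟨x i, hx i⟩
        rw [h]
        exact hx'.const_smul c }
  toFun :=
    { toFun := fun ξ => ⟨fun i => D i ⟨(ξ : lp E 2) i, ξ.2.fst i⟩, ξ.2.snd⟩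
      map_add' := by
        intro x y
        ext i
        exact (D i).map_add ⟨(x : lp E 2) i, x.2.fst i⟩ ⟨(y : lp E 2) i, y.2.fst i⟩
      map_smul' := by
        intro c x
        ext i
        exact (D i).map_smul c ⟨(x : lp E 2) i, x.2.fst i⟩ }

theorem memLp_directSum (T : ∀ i, E i →L[ℂ] E i) {C : ℝ} (hT : ∀ i, ‖T i‖ ≤ C) (ξ : lp E 2) :
    Memℓp (fun i => T i (ξ i)) 2 := by
  have h := ((lp.memℓp ξ).norm).const_mul C
  refine h.mono fun i => ?_
  exact ((T i).le_opNorm (ξ i)).trans (by gcongr; exact hT i)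

/-- The direct sum of a uniformly bounded family of bounded operators. -/
def directSumBounded (T : ∀ i, E i →L[ℂ] E i) (C : ℝ) (hC : 0 ≤ C) (hT : ∀ i, ‖T i‖ ≤ C) :
    lp E 2 →L[ℂ] lp E 2 :=
  LinearMap.mkContinuous
    { toFun := fun ξ => ⟨fun i => T i (ξ i), memLp_directSum T hT ξ⟩
      map_add' := by intro x y; ext i; exact (T i).map_add (x i) (y i)
      map_smul' := by intro c x; ext i; exact (T i).map_smul c (x i) }
    C (by
      intro ξ
      have h : ‖(C : ℂ) • ξ‖ = C * ‖ξ‖ := by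
        rw [norm_smul, Complex.norm_real, Real.norm_of_nonneg hC]
      rw [← h]
      refine lp.norm_mono (by norm_num) fun i => ?_
      have h' : ‖((C : ℂ) • ξ) i‖ = C * ‖ξ i‖ := by
        rw [lp.coeFn_smul, Pi.smul_apply, norm_smul, Complex.norm_real, Real.norm_of_nonneg hC]
      rw [h']
      exact ((T i).le_opNorm (ξ i)).trans (by gcongr; exact hT i))

end DirectSum

/-- For an unbounded operator `D` and a bounded operator `a` on `H`, the statement that the
commutator `[D, a] = D a - a D` is defined on the whole domain of `D` (that is, `a` maps the
domain of `D` into itself) and that it is bounded there with operator norm at most `C`. -/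
def CommutatorNormLE {H : Type*} [NormedAddCommGroup H] [NormedSpace ℂ H]
    (D : H →ₗ.[ℂ] H) (a : H →L[ℂ] H) (C : ℝ) : Prop :=
  ∃ h : ∀ ξ ∈ D.domain, a ξ ∈ D.domain,
    ∀ ξ : D.domain, ‖D ⟨a ξ, h ξ ξ.2⟩ - a (D ξ)‖ ≤ C * ‖(ξ : H)‖

/-! ### The Sierpinski gasket -/

/-- The Euclidean plane. -/
abbrev Plane : Type := EuclideanSpace ℝ (Fin 2)

/-- The three vertices of an equilateral triangle with side length `2π/3` and a horizontal bottom
edge, in counterclockwise order: lower right, top, lower left. -/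
def corner : Fin 3 → Plane :=
  ![!₂[2 * Real.pi / 3, 0], !₂[Real.pi / 3, Real.pi / √3], !₂[0, 0]]

/-- The composition `F_{w₁} ∘ ⋯ ∘ F_{wₙ}` along the word `w = w₁ ⋯ wₙ`, where `F_j` is the
contraction of the plane with ratio `1/2` towards `corner j`. -/
def cellMap : List (Fin 3) → Plane → Plane
  | [], x => x
  | j :: w, x => midpoint ℝ (corner j) (cellMap w x)

/-- The vertices (lower right, top, lower left) of the triangle with word `w`. -/
def vertex (w : List (Fin 3)) (k : Fin 3) : Plane := cellMap w (corner k)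

/-- The triangle with word `w`: the union of its three sides. The words of length `n` number the
`3 ^ n` triangles of size `2⁻ⁿ`. -/
def triangle (w : List (Fin 3)) : Set Plane :=
  segment ℝ (vertex w 0) (vertex w 1) ∪ segment ℝ (vertex w 1) (vertex w 2) ∪
    segment ℝ (vertex w 2) (vertex w 0)

/-- The `n`-th prefractal approximation. -/
def prefractal (n : ℕ) : Set Plane := ⋃ (w : List (Fin 3)) (_ : w.length = n), triangle w

/-- The Sierpinski gasket. -/
def gasket : Set Plane := closure (⋃ n, prefractal n)

/-- The radius `2⁻ⁿ` of the circle that parameterizes the triangles of level `n`. -/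
def radius (n : ℕ) : ℝ := (2 : ℝ)⁻¹ ^ n

/-- The perimeter `2π · 2⁻ⁿ` of the triangles of level `n`. -/
def perimeter (n : ℕ) : ℝ := 2 * Real.pi * radius n

/-- The side length of the triangles of level `n`. -/
def side (n : ℕ) : ℝ := perimeter n / 3

theorem perimeter_pos (n : ℕ) : 0 < perimeter n := by
  unfold perimeter radius
  positivity

instance (n : ℕ) : Fact (0 < perimeter n) := ⟨perimeter_pos n⟩

/-- One turn around the triangle with word `w`, for `0 ≤ t ≤ perimeter w.length`: by arclength,
counterclockwise, starting at the lower right-hand corner. -/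
def turn (w : List (Fin 3)) (t : ℝ) : Plane :=
  if t ≤ side w.length then
    AffineMap.lineMap (vertex w 0) (vertex w 1) (t / side w.length)
  else if t ≤ 2 * side w.length then
    AffineMap.lineMap (vertex w 1) (vertex w 2) (t / side w.length - 1)
  else
    AffineMap.lineMap (vertex w 2) (vertex w 0) (t / side w.length - 2)

theorem side_pos (n : ℕ) : 0 < side n := by
  unfold side
  have := perimeter_pos n
  positivity

theorem turn_mem (w : List (Fin 3)) {t : ℝ} (ht : t ∈ Icc 0 (perimeter w.length)) :
    turn w t ∈ triangle w := by
  have hs := side_pos w.length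
  have hp : perimeter w.length = 3 * side w.length := by unfold side; ring
  rw [hp] at ht
  obtain ⟨h0, h3⟩ := ht
  unfold turn triangle
  simp only [segment_eq_image_lineMap]
  have e : t / side w.length * side w.length = t := div_mul_cancel₀ _ hs.ne'
  split_ifs with h1 h2
  · exact Or.inl (Or.inl ⟨_, ⟨by positivity, by rwa [div_le_one hs]⟩, rfl⟩)
  · exact Or.inl (Or.inr ⟨_, ⟨by nlinarith, by nlinarith⟩, rfl⟩)
  · exact Or.inr ⟨_, ⟨by nlinarith, by nlinarith⟩, rfl⟩

theorem continuous_turn (w : List (Fin 3)) : Continuous (turn w) := by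
  have hs := (side_pos w.length).ne'
  unfold turn
  refine Continuous.if_le ?_ (Continuous.if_le ?_ ?_ continuous_id continuous_const ?_)
    continuous_id continuous_const ?_
  · exact AffineMap.lineMap_continuous.comp (by fun_prop)
  · exact AffineMap.lineMap_continuous.comp (by fun_prop)
  · exact AffineMap.lineMap_continuous.comp (by fun_prop)
  · rintro t rfl
    rw [mul_div_assoc, div_self hs]
    norm_num
  · rintro t rfl
    rw [if_pos (by linarith [side_pos w.length]), div_self hs]
    simp

theorem turn_zero_eq (w : List (Fin 3)) : turn w 0 = turn w (perimeter w.length) := by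
  have hs := side_pos w.length
  have hp : perimeter w.length = 3 * side w.length := by unfold side; ring
  unfold turn
  rw [hp, if_pos hs.le, if_neg (by linarith), if_neg (by linarith), mul_div_assoc,
    div_self hs.ne']
  norm_num

theorem triangle_subset (w : List (Fin 3)) : triangle w ⊆ gasket := fun _ hx =>
  subset_closure (mem_iUnion.2 ⟨w.length, mem_iUnion₂.2 ⟨w, rfl, hx⟩⟩)

/-- The parameterization of the triangle with word `w` by the circle of the same perimeter (that
is, of radius `2⁻ⁿ`): by arclength, counterclockwise, starting at the lower right-hand corner. -/
def loop (w : List (Fin 3)) : C(AddCircle (perimeter w.length), gasket) where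
  toFun s := ⟨AddCircle.liftIco (perimeter w.length) 0 (turn w) s, by
    obtain ⟨t, ht, rfl⟩ : ∃ t ∈ Ico 0 (perimeter w.length), (t : AddCircle _) = s := by
      have := AddCircle.coe_image_Ico_eq (perimeter w.length) 0 ▸ mem_univ s
      simpa using this
    rw [AddCircle.liftIco_zero_coe_apply ht]
    exact triangle_subset w (turn_mem w (Ico_subset_Icc_self ht))⟩
  continuous_toFun := Continuous.subtype_mk
    (AddCircle.liftIco_zero_continuous (turn_zero_eq w) (continuous_turn w).continuousOn) _

theorem isBounded_gasket : Bornology.IsBounded gasket := by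
  obtain ⟨R, hR⟩ : ∃ R, ∀ k, corner k ∈ Metric.closedBall (0 : Plane) R := by
    refine ⟨∑ k, ‖corner k‖, fun k => ?_⟩
    rw [mem_closedBall_zero_iff]
    exact Finset.single_le_sum (f := fun k => ‖corner k‖) (fun _ _ => norm_nonneg _)
      (Finset.mem_univ k)
  have hc := convex_closedBall (0 : Plane) R
  have hv : ∀ w k, vertex w k ∈ Metric.closedBall (0 : Plane) R := by
    intro w k
    unfold vertex
    induction w with
    | nil => exact hR k
    | cons j w ih => exact hc.midpoint_mem (hR j) ih
  refine (Metric.isBounded_closedBall (x := (0 : Plane)) (r := R)).subset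
    (closure_minimal ?_ Metric.isClosed_closedBall)
  refine iUnion_subset fun n => iUnion₂_subset fun w _ => union_subset (union_subset ?_ ?_) ?_
  all_goals exact hc.segment_subset (hv _ _) (hv _ _)

instance : CompactSpace gasket :=
  isCompact_iff_compactSpace.1 (Metric.isCompact_of_isClosed_isBounded isClosed_closure
    isBounded_gasket)

/-! ### The spectral triple of the gasket -/

/-- The Hilbert space `L²` of the circle of circumference `T`, with normalized Lebesgue measure. -/
abbrev CircleL2 (T : ℝ) [Fact (0 < T)] : Type :=
  Lp ℂ 2 (AddCircle.haarAddCircle : Measure (AddCircle T))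

/-- Multiplication by a continuous function on the circle, as a bounded operator on `L²`. -/
def multiplication {T : ℝ} [Fact (0 < T)] (g : C(AddCircle T, ℂ)) :
    CircleL2 T →L[ℂ] CircleL2 T :=
  LinearMap.mkContinuous
    { toFun := fun ξ => (ContinuousMap.toLp ∞ AddCircle.haarAddCircle ℂ g • ξ : CircleL2 T)
      map_add' := fun x y => Lp.add_smul _ x y
      map_smul' := fun c x => (Lp.smul_comm c _ x).symm }
    ‖g‖ (by
      intro ξ
      refine (Lp.norm_smul_le _ ξ).trans ?_
      gcongr
      refine Lp.norm_le_of_ae_bound (norm_nonneg g) ?_ |>.trans ?_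
      · filter_upwards [ContinuousMap.coeFn_toLp (p := ∞) (𝕜 := ℂ) AddCircle.haarAddCircle g]
          with x hx
        rw [hx]
        exact g.norm_coe_le_norm x
      · simp)

theorem norm_multiplication_le {T : ℝ} [Fact (0 < T)] (g : C(AddCircle T, ℂ)) :
    ‖multiplication g‖ ≤ ‖g‖ :=
  LinearMap.mkContinuous_norm_le _ (norm_nonneg g) _

/-- The translated Dirac operator `-i d/dx + 1/(2r)` on the circle of radius `r = 2⁻ⁿ`: the
exponential `x ↦ exp (i k x / r)` is an eigenvector with eigenvalue `k / r + 1 / (2 r)`. -/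
def circleDirac (n : ℕ) : CircleL2 (perimeter n) →ₗ.[ℂ] CircleL2 (perimeter n) :=
  diagonalOperator fourierBasis fun k : ℤ => k / radius n + 1 / (2 * radius n)

/-- The Hilbert space of the gasket: the direct sum of the `L²` spaces of all triangles. -/
abbrev GasketHilbert : Type :=
  lp (fun w : List (Fin 3) => CircleL2 (perimeter w.length)) 2

/-- The representation of the continuous functions on the gasket: on the summand of the triangle
`w`, the function `f` acts as multiplication by `f ∘ loop w`. -/
def gasketRep (f : C(gasket, ℂ)) : GasketHilbert →L[ℂ] GasketHilbert :=
  directSumBounded (fun w => multiplication (f.comp (loop w))) ‖f‖ (norm_nonneg f) fun w =>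
    (norm_multiplication_le _).trans
      ((ContinuousMap.norm_le _ (norm_nonneg f)).2 fun s => f.norm_coe_le_norm (loop w s))

/-- The Dirac operator of the gasket: the direct sum of the translated Dirac operators of all
triangles. -/
def gasketDirac : GasketHilbert →ₗ.[ℂ] GasketHilbert :=
  directSumOperator fun w => circleDirac w.length

/-- The distance that the spectral triple of the gasket induces on the gasket:
`sup {|f p - f q| : ‖[D, π f]‖ ≤ 1}`. -/
def spectralDist (p q : gasket) : ℝ≥0∞ :=
  ⨆ f ∈ {f : C(gasket, ℂ) | CommutatorNormLE gasketDirac (gasketRep f) 1}, ‖f p - f q‖ₑ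

/-! ### The geodesic distance -/

/-- The geodesic distance on the gasket: the infimum of the lengths of the rectifiable continuous
curves in the gasket from `p` to `q`. -/
def geodesicDist (p q : gasket) : ℝ≥0∞ :=
  ⨅ γ ∈ {γ : Path p q | BoundedVariationOn γ univ}, eVariationOn γ univ

end SierpinskiGasket

end

open MeasureTheory Set
open scoped ENNReal NNReal unitInterval

noncomputable section

namespace SierpinskiGasket

/-! On a circle, `[D, g]` is multiplication by `-i g'`, so its norm is at most 1 exactly when `g` is
1-Lipschitz for arclength. As the Dirac operator is a direct sum, `f` is admissible for the spectral
distance if and only if each `f ∘ loop w` is 1-Lipschitz. This is made rigorous without derivatives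
of `g`. The group `exp (i t D)` is translation by `t` times a scalar phase (the shift by 1/2
contributes only the phase), and its commutator with multiplication by `g` is, up to a unitary
factor, multiplication by `g - g(· + t)`. A commutator bound for `D` is equivalent to the bound
`|t|` for the commutators with the group (`IsUnitaryGroup.norm_commutator_le`,
`IsUnitaryGroup.commutatorNormLE`).

Spectral distance at most geodesic distance (`edist_le_eVariationOn`): an admissible `f` varies by
at most one side length between vertices of a triangle. Distinct cells of level `n` meet only in
vertices, so a curve that leaves a cell for the last time does so at a vertex. Cutting the curve at
the last exits from the cells of level `n` gives finitely many pieces. Except for the first and the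
last piece, each joins vertices of a common cell, and there the variation of `f` is at most the
chord, hence at most the length of the piece. The two exceptional pieces cost little for large `n`,
by uniform continuity of `f`.

Geodesic distance at most spectral distance (`commutatorNormLE_distanceFrom`): the extremal function
is the geodesic distance from `p`. It is finite and continuous because cells of level `n` have
geodesic diameter of order `2⁻ⁿ`, which follows by joining a point to a vertex of its cell through
infinitely many segments (`geodesicDist_vertex_le`). It is 1-Lipschitz along each triangle because
the sides lie in the gasket. -/

/-! ### Barycentric coordinates and cells -/

/-- The barycentric coordinates of a point of the plane with respect to the three corners. -/
def bary (i : Fin 3) (x : Plane) : ℝ :=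
  ![(x 0 - x 1 / √3) * (3 / (2 * Real.pi)), x 1 * √3 / Real.pi,
    1 - (x 0 - x 1 / √3) * (3 / (2 * Real.pi)) - x 1 * √3 / Real.pi] i

theorem sum_bary (x : Plane) : ∑ i, bary i x = 1 := by
  simp [Fin.sum_univ_three, bary]

theorem bary_corner (i j : Fin 3) : bary i (corner j) = if i = j then 1 else 0 := by
  have h3 : √3 * √3 = (3 : ℝ) := Real.mul_self_sqrt (by norm_num)
  have h3' : √3 ≠ (0 : ℝ) := by positivity
  have hpi := Real.pi_ne_zero
  have e1 : (Real.pi / 3 - Real.pi / √3 / √3) = 0 := by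
    rw [div_div, h3]; ring
  fin_cases i <;> fin_cases j <;> simp [bary, corner, e1]

theorem bary_midpoint (i : Fin 3) (x y : Plane) :
    bary i (midpoint ℝ x y) = (bary i x + bary i y) / 2 := by
  have h (k : Fin 2) : (midpoint ℝ x y) k = (x k + y k) / 2 := by
    rw [midpoint_eq_smul_add]
    simp
    ring
  fin_cases i <;> simp [bary, h] <;> ring

theorem eq_sum_bary_smul (x : Plane) : x = ∑ i, bary i x • corner i := by
  have h3 : √3 * √3 = (3 : ℝ) := Real.mul_self_sqrt (by norm_num)
  have h3' : √3 ≠ (0 : ℝ) := by positivity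
  have hpi := Real.pi_ne_zero
  ext k
  fin_cases k
  · have e1 : x 1 * √3 / Real.pi * (Real.pi / 3) = x 1 / √3 := by
      field_simp
      rw [sq, h3]
    simp only [Fin.sum_univ_three, bary, corner]
    simp [e1]
    field_simp
    ring
  · simp [Fin.sum_univ_three, bary, corner]
    field_simp

theorem continuous_bary (i : Fin 3) : Continuous (bary i) := by
  unfold bary
  fin_cases i <;> simp <;> fun_prop

/-- The solid triangle spanned by the three corners. -/
def solid : Set Plane := {x | ∀ i, 0 ≤ bary i x}

theorem corner_mem_solid (j : Fin 3) : corner j ∈ solid := by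
  intro i
  rw [bary_corner]
  split_ifs <;> norm_num

theorem bary_le_one {x : Plane} (hx : x ∈ solid) (i : Fin 3) : bary i x ≤ 1 := by
  rw [← sum_bary x]
  exact Finset.single_le_sum (f := fun i => bary i x) (fun i _ => hx i) (Finset.mem_univ i)

theorem eq_corner_of_bary_eq_one {x : Plane} (hx : x ∈ solid) {j : Fin 3} (h : bary j x = 1) :
    x = corner j := by
  have hs := Finset.sum_erase_add (s := Finset.univ) (f := fun i => bary i x)
    (Finset.mem_univ j)
  rw [sum_bary, h] at hs
  have h0 : ∑ i ∈ Finset.univ.erase j, bary i x = 0 := by linarith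
  rw [Finset.sum_eq_zero_iff_of_nonneg fun i _ => hx i] at h0
  rw [eq_sum_bary_smul x, ← Finset.sum_erase_add _ _ (Finset.mem_univ j), h, one_smul,
    Finset.sum_eq_zero, zero_add]
  intro i hi
  rw [h0 i hi, zero_smul]

theorem isCompact_solid : IsCompact solid := by
  refine Metric.isCompact_of_isClosed_isBounded ?_ ?_
  · have : solid = ⋂ i, {x | 0 ≤ bary i x} := by ext; simp [solid]
    rw [this]
    exact isClosed_iInter fun i => isClosed_le continuous_const (continuous_bary i)
  · refine (Metric.isBounded_closedBall (x := (0 : Plane)) (r := ∑ i, ‖corner i‖)).subset ?_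
    intro x hx
    rw [mem_closedBall_zero_iff, eq_sum_bary_smul x]
    refine norm_sum_le_of_le _ fun i _ => ?_
    rw [norm_smul, Real.norm_of_nonneg (hx i)]
    exact mul_le_of_le_one_left (norm_nonneg _) (bary_le_one hx i)

theorem convex_solid : Convex ℝ solid := by
  have h : solid = ⋂ i, {x | 0 ≤ bary i x} := by ext; simp [solid]
  rw [h]
  refine convex_iInter fun i => ?_
  intro x hx y hy a b ha hb hab
  have e : bary i (a • x + b • y) = a * bary i x + b * bary i y := by
    fin_cases i
    · simp [bary]; ring
    · simp [bary]; ring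
    · simp [bary]; linear_combination (-1 : ℝ) * hab
  change 0 ≤ bary i (a • x + b • y)
  rw [e]
  exact add_nonneg (mul_nonneg ha hx) (mul_nonneg hb hy)

theorem cellMap_mem_solid (w : List (Fin 3)) {x : Plane} (hx : x ∈ solid) :
    cellMap w x ∈ solid := by
  induction w with
  | nil => exact hx
  | cons j w ih => exact convex_solid.midpoint_mem (corner_mem_solid j) ih

theorem cellMap_append (u w : List (Fin 3)) (x : Plane) :
    cellMap (u ++ w) x = cellMap u (cellMap w x) := by
  induction u with
  | nil => rfl
  | cons j u ih => simp [cellMap, ih]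

theorem cellMap_eq (w : List (Fin 3)) (x : Plane) :
    cellMap w x = cellMap w 0 + radius w.length • x := by
  induction w with
  | nil => simp [cellMap, radius]
  | cons j w ih =>
    simp only [cellMap, List.length_cons, radius, midpoint_eq_smul_add, pow_succ] at ih ⊢
    rw [ih]
    simp only [smul_add, smul_smul, invOf_eq_inv]
    rw [mul_comm (2⁻¹ : ℝ), add_assoc]

theorem radius_pos (n : ℕ) : 0 < radius n := by unfold radius; positivity

theorem dist_cellMap (w : List (Fin 3)) (x y : Plane) :
    dist (cellMap w x) (cellMap w y) = radius w.length * dist x y := by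
  rw [cellMap_eq w x, cellMap_eq w y, dist_add_left, dist_smul₀,
    Real.norm_of_nonneg (radius_pos _).le]

theorem cellMap_midpoint (w : List (Fin 3)) (x y : Plane) :
    cellMap w (midpoint ℝ x y) = midpoint ℝ (cellMap w x) (cellMap w y) := by
  rw [cellMap_eq w (midpoint ℝ x y), cellMap_eq w x, cellMap_eq w y]
  simp only [midpoint_eq_smul_add, invOf_eq_inv]
  module

theorem vertex_append_singleton (w : List (Fin 3)) (j k : Fin 3) :
    vertex (w ++ [j]) k = midpoint ℝ (vertex w j) (vertex w k) := by
  simp [vertex, cellMap_append, cellMap, cellMap_midpoint]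

/-- The solid triangle with word `w`. -/
def cell (w : List (Fin 3)) : Set Plane := cellMap w '' solid

theorem continuous_cellMap (w : List (Fin 3)) : Continuous (cellMap w) := by
  rw [funext (cellMap_eq w)]
  fun_prop

theorem isClosed_cell (w : List (Fin 3)) : IsClosed (cell w) :=
  (isCompact_solid.image (continuous_cellMap w)).isClosed

theorem convex_cell (w : List (Fin 3)) : Convex ℝ (cell w) := by
  have := convex_solid.affinity (cellMap w 0) (radius w.length)
  rwa [cell, funext (cellMap_eq w)]

theorem vertex_mem_cell (w : List (Fin 3)) (k : Fin 3) : vertex w k ∈ cell w :=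
  mem_image_of_mem _ (corner_mem_solid k)

theorem cell_append_subset (u w : List (Fin 3)) : cell (u ++ w) ⊆ cell u := by
  rintro _ ⟨x, hx, rfl⟩
  exact ⟨cellMap w x, cellMap_mem_solid w hx, (cellMap_append u w x).symm⟩

theorem mem_triangle {w : List (Fin 3)} {x : Plane} :
    x ∈ triangle w ↔ ∃ i j, x ∈ segment ℝ (vertex w i) (vertex w j) := by
  constructor
  · rintro ((h | h) | h)
    exacts [⟨_, _, h⟩, ⟨_, _, h⟩, ⟨_, _, h⟩]
  · rintro ⟨i, j, h⟩
    have h0 : ∀ k, vertex w k ∈ triangle w := by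
      intro k
      fin_cases k
      exacts [Or.inl (Or.inl (left_mem_segment ℝ _ _)), Or.inl (Or.inl (right_mem_segment ℝ _ _)),
        Or.inr (left_mem_segment ℝ _ _)]
    by_cases hij : i = j
    · subst hij
      rw [segment_same] at h
      rw [h]
      exact h0 i
    · fin_cases i <;> fin_cases j <;> first
        | exact absurd rfl hij
        | exact Or.inl (Or.inl h)
        | exact Or.inl (Or.inr h)
        | exact Or.inr h
        | (rw [segment_symm] at h; exact Or.inl (Or.inl h))
        | (rw [segment_symm] at h; exact Or.inl (Or.inr h))
        | (rw [segment_symm] at h; exact Or.inr h)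

theorem triangle_subset_cell (w : List (Fin 3)) : triangle w ⊆ cell w := by
  intro x hx
  obtain ⟨i, j, h⟩ := mem_triangle.1 hx
  exact (convex_cell w).segment_subset (vertex_mem_cell w i) (vertex_mem_cell w j) h

theorem segment_subset_midpoint (a b : Plane) :
    segment ℝ a b ⊆ segment ℝ a (midpoint ℝ a b) ∪ segment ℝ (midpoint ℝ a b) b := by
  rw [segment_eq_image_lineMap]
  rintro _ ⟨t, ⟨h0, h1⟩, rfl⟩
  rcases le_total t 2⁻¹ with h | h
  · left
    rw [segment_eq_image_lineMap]
    refine ⟨2 * t, ⟨by linarith, by linarith⟩, ?_⟩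
    simp only [AffineMap.lineMap_apply_module, midpoint_eq_smul_add, invOf_eq_inv]
    module
  · right
    rw [segment_eq_image_lineMap]
    refine ⟨2 * t - 1, ⟨by linarith, by linarith⟩, ?_⟩
    simp only [AffineMap.lineMap_apply_module, midpoint_eq_smul_add, invOf_eq_inv]
    module

theorem triangle_subset_iUnion (w : List (Fin 3)) : triangle w ⊆ ⋃ j, triangle (w ++ [j]) := by
  intro x hx
  obtain ⟨i, j, h⟩ := mem_triangle.1 hx
  rw [mem_iUnion]
  rcases segment_subset_midpoint _ _ h with h | h
  · refine ⟨i, mem_triangle.2 ⟨i, j, ?_⟩⟩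
    rwa [vertex_append_singleton, vertex_append_singleton, midpoint_self]
  · refine ⟨j, mem_triangle.2 ⟨i, j, ?_⟩⟩
    rwa [vertex_append_singleton, vertex_append_singleton, midpoint_self, midpoint_comm]

theorem prefractal_subset_succ (n : ℕ) : prefractal n ⊆ prefractal (n + 1) := by
  intro x hx
  obtain ⟨w, rfl, hw⟩ := mem_iUnion₂.1 hx
  obtain ⟨j, hj⟩ := mem_iUnion.1 (triangle_subset_iUnion w hw)
  exact mem_iUnion₂.2 ⟨w ++ [j], by simp, hj⟩

theorem finite_words (n : ℕ) : {w : List (Fin 3) | w.length = n}.Finite :=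
  List.finite_length_eq _ n

theorem gasket_subset_cells (n : ℕ) :
    gasket ⊆ ⋃ w ∈ {w : List (Fin 3) | w.length = n}, cell w := by
  refine closure_minimal (iUnion_subset fun m => ?_)
    ((finite_words n).isClosed_biUnion fun w _ => isClosed_cell w)
  refine (monotone_nat_of_le_succ prefractal_subset_succ (le_max_left m n)).trans fun x hx => ?_
  obtain ⟨w, hw, hx⟩ := mem_iUnion₂.1 hx
  rw [mem_iUnion₂]
  refine ⟨w.take n, by simp [hw], ?_⟩
  apply cell_append_subset _ (w.drop n)
  rw [List.take_append_drop]
  exact triangle_subset_cell w hx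

/-- An average of two numbers that are at most 1 equals 1 only if both do, so the coordinate 1 is
inherited at each midpoint. -/
theorem eq_corner_of_bary_cellMap_eq_one (w : List (Fin 3)) {x : Plane} (hx : x ∈ solid)
    {j : Fin 3} (h : bary j (cellMap w x) = 1) : x = corner j := by
  induction w with
  | nil => exact eq_corner_of_bary_eq_one hx h
  | cons k w ih =>
    refine ih ?_
    rw [cellMap, bary_midpoint, bary_corner] at h
    have := bary_le_one (cellMap_mem_solid w hx) j
    split_ifs at h <;> linarith

/-- After the common prefix is removed, the first letters are `i ≠ j`. The `j`-th coordinate is then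
at most 1/2 on the left and at least 1/2 on the right; equality makes `x` the corner `j`. -/
theorem exists_eq_corner_of_cellMap_eq {u w : List (Fin 3)} (hl : u.length = w.length)
    (hne : u ≠ w) {x y : Plane} (hx : x ∈ solid) (hy : y ∈ solid)
    (h : cellMap u x = cellMap w y) : ∃ j, x = corner j := by
  induction u generalizing w with
  | nil => exact absurd (List.length_eq_zero_iff.1 hl.symm).symm hne
  | cons i u ih =>
    cases w with
    | nil => simp at hl
    | cons j w =>
      have hb (k : Fin 3) := congrArg (bary k) h
      simp only [cellMap, bary_midpoint, bary_corner] at hb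
      by_cases hij : i = j
      · subst hij
        refine ih (w := w) (by simpa using hl) (fun e => hne (by rw [e])) ?_
        rw [eq_sum_bary_smul (cellMap u x), eq_sum_bary_smul (cellMap w y)]
        refine Finset.sum_congr rfl fun k _ => ?_
        congr 1
        linarith [hb k]
      · refine ⟨j, eq_corner_of_bary_cellMap_eq_one u hx ?_⟩
        have h1 := hb j
        rw [if_neg (Ne.symm hij), if_pos rfl] at h1
        have h2 := cellMap_mem_solid w hy j
        linarith [bary_le_one (cellMap_mem_solid u hx) j]

/-- Distinct cells of the same level meet at most in common vertices. -/
theorem exists_eq_vertex {u w : List (Fin 3)} (hl : u.length = w.length)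
    (hne : u ≠ w) {x : Plane} (hu : x ∈ cell u) (hw : x ∈ cell w) : ∃ j, x = vertex u j := by
  obtain ⟨y, hy, rfl⟩ := hu
  obtain ⟨z, hz, h⟩ := hw
  obtain ⟨j, rfl⟩ := exists_eq_corner_of_cellMap_eq hl hne hy hz h.symm
  exact ⟨j, rfl⟩

theorem vertex_mem_cell_append_singleton (w : List (Fin 3)) (j : Fin 3) :
    vertex w j ∈ cell (w ++ [j]) := by
  have := vertex_mem_cell (w ++ [j]) j
  rwa [vertex_append_singleton, midpoint_self] at this

/-- A cell of the next level that contains `x` may have a parent other than `w`. Then `x` is a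
vertex of `w`, and each vertex of `w` belongs to a child of `w`. -/
theorem exists_mem_cell_append_singleton {w : List (Fin 3)} {x : Plane} (hx : x ∈ gasket)
    (hw : x ∈ cell w) : ∃ j, x ∈ cell (w ++ [j]) := by
  obtain ⟨u, hu, hxu⟩ := mem_iUnion₂.1 (gasket_subset_cells (w.length + 1) hx)
  have hu' : u ≠ [] := by rintro rfl; simp at hu
  have hd := List.dropLast_append_getLast hu'
  by_cases h : u.dropLast = w
  · exact ⟨u.getLast hu', by rwa [← h, hd]⟩
  · have hxu' : x ∈ cell u.dropLast := by
      rw [← hd] at hxu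
      exact cell_append_subset _ _ hxu
    have hl : w.length = u.dropLast.length := by
      rw [List.length_dropLast, show u.length = w.length + 1 from hu]; simp
    obtain ⟨j, rfl⟩ := exists_eq_vertex hl (Ne.symm h) hw hxu'
    exact ⟨j, vertex_mem_cell_append_singleton w j⟩

theorem segment_vertex_subset (w : List (Fin 3)) (i j : Fin 3) :
    segment ℝ (vertex w i) (vertex w j) ⊆ gasket := fun _ hx =>
  triangle_subset w (mem_triangle.2 ⟨i, j, hx⟩)

theorem vertex_mem_gasket (w : List (Fin 3)) (i : Fin 3) : vertex w i ∈ gasket :=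
  segment_vertex_subset w i i (left_mem_segment ℝ _ _)

theorem dist_corner {i j : Fin 3} (h : i ≠ j) : dist (corner i) (corner j) = 2 * Real.pi / 3 := by
  have hp := Real.pi_pos
  have h3 : √3 ^ 2 = (3 : ℝ) := Real.sq_sqrt (by norm_num)
  have e : ∀ a b : ℝ, a ^ 2 + b ^ 2 = (2 * Real.pi / 3) ^ 2 →
      √(a ^ 2 + b ^ 2) = 2 * Real.pi / 3 := by
    intro a b h
    rw [h, Real.sqrt_sq (by positivity)]
  fin_cases i <;> fin_cases j <;> first
    | exact absurd rfl h
    | (simp only [EuclideanSpace.dist_eq, Fin.sum_univ_two, Real.dist_eq, sq_abs]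
       apply e
       simp [corner]
       try field_simp
       try rw [h3]
       try ring)

theorem dist_vertex (w : List (Fin 3)) {i j : Fin 3} (h : i ≠ j) :
    dist (vertex w i) (vertex w j) = side w.length := by
  rw [vertex, vertex, dist_cellMap, dist_corner h, side, perimeter]
  ring

/-- A bound for the diameter of the solid triangle. -/
theorem exists_dist_le_of_mem_cell :
    ∃ R : ℝ, 0 ≤ R ∧ ∀ w : List (Fin 3), ∀ x ∈ cell w, ∀ y ∈ cell w,
      dist x y ≤ R * radius w.length := by
  obtain ⟨R, hR⟩ := Metric.isBounded_iff.1 isCompact_solid.isBounded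
  refine ⟨R, dist_nonneg.trans (hR (corner_mem_solid 0) (corner_mem_solid 0)), ?_⟩
  rintro w _ ⟨x, hx, rfl⟩ _ ⟨y, hy, rfl⟩
  rw [dist_cellMap, mul_comm]
  exact mul_le_mul_of_nonneg_right (hR hx hy) (radius_pos _).le

theorem tendsto_radius : Filter.Tendsto radius Filter.atTop (nhds 0) :=
  tendsto_pow_atTop_nhds_zero_of_lt_one (by norm_num) (by norm_num)

/-! ### The geodesic distance -/

section Paths

open Filter Topology

/-! ### The geodesic distance as a pseudometric. -/

theorem geodesicDist_eq_iInf (p q : gasket) :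
    geodesicDist p q = ⨅ γ : Path p q, eVariationOn γ univ := by
  refine le_antisymm (le_iInf fun γ => ?_) (le_iInf₂ fun γ _ => iInf_le _ γ)
  by_cases h : BoundedVariationOn γ univ
  · exact iInf₂_le γ h
  · rw [BoundedVariationOn, not_ne_iff] at h
    rw [h]
    exact le_top

theorem geodesicDist_le (p q : gasket) (γ : Path p q) :
    geodesicDist p q ≤ eVariationOn γ univ := by
  rw [geodesicDist_eq_iInf]
  exact iInf_le _ γ

theorem geodesicDist_self (p : gasket) : geodesicDist p p = 0 := by
  refine le_antisymm ((geodesicDist_le p p (Path.refl p)).trans (le_of_eq ?_)) bot_le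
  refine eVariationOn.constant_on ?_
  rintro _ ⟨a, -, rfl⟩ _ ⟨b, -, rfl⟩
  rfl

theorem geodesicDist_comm_le (p q : gasket) : geodesicDist p q ≤ geodesicDist q p := by
  rw [geodesicDist_eq_iInf q p]
  refine le_iInf fun γ => (geodesicDist_le p q γ.symm).trans ?_
  have hσ : Antitone unitInterval.symm := fun a b h => by
    rw [← Subtype.coe_le_coe, unitInterval.coe_symm_eq, unitInterval.coe_symm_eq]
    have : (a : ℝ) ≤ b := h
    linarith
  exact eVariationOn.comp_le_of_antitoneOn γ _ (hσ.antitoneOn _) (mapsTo_univ _ _)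

theorem geodesicDist_comm (p q : gasket) : geodesicDist p q = geodesicDist q p :=
  le_antisymm (geodesicDist_comm_le p q) (geodesicDist_comm_le q p)

theorem eVariationOn_trans_le {X : Type*} [PseudoEMetricSpace X] {x y z : X} (γ : Path x y)
    (γ' : Path y z) :
    eVariationOn (γ.trans γ') univ ≤ eVariationOn γ univ + eVariationOn γ' univ := by
  set c : I := ⟨1 / 2, by norm_num, by norm_num⟩
  have h0 : (0 : I) ≤ c := c.2.1
  have h1 : c ≤ 1 := c.2.2
  have hu : (univ : Set I) ∩ Icc 0 1 = univ := by
    ext t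
    exact ⟨fun _ => mem_univ _, fun _ => ⟨mem_univ _, t.2.1, t.2.2⟩⟩
  have hsplit := eVariationOn.Icc_add_Icc (γ.trans γ') h0 h1 (mem_univ c)
  rw [hu, univ_inter, univ_inter] at hsplit
  rw [← hsplit]
  have e1 : EqOn (γ.trans γ') (γ ∘ fun t : I => projIcc 0 1 zero_le_one (2 * (t : ℝ)))
      (Icc 0 c) := by
    rintro t ⟨-, ht⟩
    have ht' : (t : ℝ) ≤ 1 / 2 := ht
    rw [Path.trans_apply, dif_pos ht', Function.comp_apply,
      projIcc_of_mem zero_le_one ((unitInterval.mul_pos_mem_iff zero_lt_two).2 ⟨t.2.1, ht'⟩)]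
  have e2 : EqOn (γ.trans γ') (γ' ∘ fun t : I => projIcc 0 1 zero_le_one (2 * (t : ℝ) - 1))
      (Icc c 1) := by
    rintro t ⟨ht, -⟩
    have ht' : 1 / 2 ≤ (t : ℝ) := ht
    rw [Function.comp_apply, projIcc_of_mem zero_le_one
      (unitInterval.two_mul_sub_one_mem_iff.2 ⟨ht', t.2.2⟩)]
    -- At `t = 1/2` the concatenation is still given by `γ`, so the formula with `γ'` needs `γ 1 =
    -- γ' 0`.
    rcases ht'.eq_or_lt with h | h
    · rw [Path.trans_apply, dif_pos h.ge]
      have hs : (⟨2 * (t : ℝ), (unitInterval.mul_pos_mem_iff zero_lt_two).2 ⟨t.2.1, h.ge⟩⟩ : I)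
          = 1 := by
        ext
        simp [← h]
      have hs' : (⟨2 * (t : ℝ) - 1, unitInterval.two_mul_sub_one_mem_iff.2 ⟨ht', t.2.2⟩⟩ : I)
          = 0 := by
        ext
        simp [← h]
      rw [hs, hs', γ.target, γ'.source]
    · rw [Path.trans_apply, dif_neg h.not_ge]
  rw [eVariationOn.eq_of_eqOn e1, eVariationOn.eq_of_eqOn e2]
  have hm : Monotone (fun t : I => projIcc 0 1 (zero_le_one (α := ℝ)) (2 * (t : ℝ))) :=
    fun a b h => monotone_projIcc _ (by have : (a : ℝ) ≤ b := h; linarith)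
  have hm' : Monotone (fun t : I => projIcc 0 1 (zero_le_one (α := ℝ)) (2 * (t : ℝ) - 1)) :=
    fun a b h => monotone_projIcc _ (by have : (a : ℝ) ≤ b := h; linarith)
  have i1 := eVariationOn.comp_le_of_monotoneOn γ (s := univ) _ (hm.monotoneOn (Icc 0 c))
    (mapsTo_univ _ _)
  have i2 := eVariationOn.comp_le_of_monotoneOn γ' (s := univ) _ (hm'.monotoneOn (Icc c 1))
    (mapsTo_univ _ _)
  exact add_le_add i1 i2

theorem geodesicDist_triangle (p q r : gasket) :
    geodesicDist p r ≤ geodesicDist p q + geodesicDist q r := by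
  rw [geodesicDist_eq_iInf p q, geodesicDist_eq_iInf q r]
  exact ENNReal.le_iInf_add_iInf fun γ γ' =>
    (geodesicDist_le p r (γ.trans γ')).trans (eVariationOn_trans_le γ γ')

/-- The piecewise affine function that increases from `0` to `1` on `[2⁻ᵐ⁻¹, 2⁻ᵐ]`. -/
def ramp (m : ℕ) (t : ℝ) : ℝ := max 0 (min 1 (2 ^ (m + 1) * t - 1))

theorem ramp_nonneg (m : ℕ) (t : ℝ) : 0 ≤ ramp m t := le_max_left _ _

theorem ramp_le_one (m : ℕ) (t : ℝ) : ramp m t ≤ 1 := max_le zero_le_one (min_le_left _ _)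

theorem ramp_eq_zero {m : ℕ} {t : ℝ} (h : 2 ^ (m + 1) * t ≤ 1) : ramp m t = 0 :=
  max_eq_left ((min_le_right _ _).trans (by linarith))

theorem ramp_eq_one {m : ℕ} {t : ℝ} (h : 2 ≤ 2 ^ (m + 1) * t) : ramp m t = 1 := by
  rw [ramp, min_eq_left (by linarith), max_eq_right zero_le_one]

theorem continuous_ramp (m : ℕ) : Continuous (ramp m) := by unfold ramp; fun_prop

theorem monotone_ramp (m : ℕ) : Monotone (ramp m) := by
  intro s t h
  unfold ramp
  gcongr

theorem ramp_one (m : ℕ) : ramp m 1 = 1 :=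
  ramp_eq_one (by rw [mul_one, pow_succ]; nlinarith [one_le_pow₀ (one_le_two (α := ℝ)) (n := m)])

/-! ### Curves made of infinitely many segments. -/

section Concatenation

variable {x : ℕ → Plane} {q : Plane}

theorem hasSum_sub_of_tendsto (hs : Summable fun m => dist (x m) (x (m + 1)))
    (hq : Tendsto x atTop (𝓝 q)) (M : ℕ) :
    HasSum (fun m => x (m + M) - x (m + M + 1)) (x M - q) := by
  have hs' : Summable fun m => x (m + M) - x (m + M + 1) := by
    refine Summable.of_norm ?_
    simp_rw [← dist_eq_norm]
    exact (summable_nat_add_iff M).2 hs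
  refine (hs'.hasSum_iff_tendsto_nat).2 ?_
  have e : (fun n => ∑ i ∈ Finset.range n, (x (i + M) - x (i + M + 1))) =
      fun n => x M - x (n + M) := by
    ext1 n
    have := Finset.sum_range_sub' (fun i => x (i + M)) n
    simpa [add_right_comm] using this
  rw [e]
  exact tendsto_const_nhds.sub ((tendsto_add_atTop_iff_nat M).2 hq)

theorem summable_ramp (hs : Summable fun m => dist (x m) (x (m + 1))) (t : ℝ) :
    Summable fun m => ramp m t • (x m - x (m + 1)) := by
  refine Summable.of_norm_bounded hs fun m => ?_
  rw [norm_smul, ← dist_eq_norm, Real.norm_of_nonneg (ramp_nonneg m t)]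
  exact mul_le_of_le_one_left dist_nonneg (ramp_le_one m t)

/-- The concatenation, run backwards, of the segments of an infinite polygon tending to `q`. -/
def polygon (x : ℕ → Plane) (q : Plane) (t : ℝ) : Plane :=
  q + ∑' m, ramp m t • (x m - x (m + 1))

theorem polygon_zero : polygon x q 0 = q := by
  simp [polygon, ramp_eq_zero]

theorem polygon_one (hs : Summable fun m => dist (x m) (x (m + 1)))
    (hq : Tendsto x atTop (𝓝 q)) : polygon x q 1 = x 0 := by
  have h := (hasSum_sub_of_tendsto hs hq 0).tsum_eq
  simp only [add_zero] at h
  simp [polygon, ramp_one, h]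

/-- For `2⁻ᴹ⁻¹ < t ≤ 2⁻ᴹ`, the ramps before `M` vanish and those after `M` equal 1. The latter
telescope, which leaves `x (M + 1) + ramp M t • (x M - x (M + 1))`. -/
theorem polygon_mem_segment (hs : Summable fun m => dist (x m) (x (m + 1)))
    (hq : Tendsto x atTop (𝓝 q)) {t : ℝ} (h0 : 0 < t) (h1 : t ≤ 1) :
    ∃ M, polygon x q t ∈ segment ℝ (x M) (x (M + 1)) := by
  obtain ⟨M, hM, hM'⟩ := exists_nat_pow_near ((one_le_inv₀ h0).2 h1) (one_lt_two (α := ℝ))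
  refine ⟨M, ?_⟩
  have hM : 2 ^ M * t ≤ 1 := by
    rwa [← le_div_iff₀ h0, one_div]
  have hM' : 1 < 2 ^ (M + 1) * t := by
    rwa [← div_lt_iff₀ h0, one_div]
  have htail : ∑' m, ramp (m + (M + 1)) t • (x (m + (M + 1)) - x (m + (M + 1) + 1)) =
      x (M + 1) - q := by
    rw [← (hasSum_sub_of_tendsto hs hq (M + 1)).tsum_eq]
    refine tsum_congr fun m => ?_
    rw [ramp_eq_one, one_smul]
    have : (2 : ℝ) ^ (m + (M + 1) + 1) * t = 2 ^ m * (2 ^ (M + 1) * t) * 2 := by ring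
    rw [this]
    nlinarith [one_le_pow₀ (one_le_two (α := ℝ)) (n := m)]
  have hhead : ∑ m ∈ Finset.range M, ramp m t • (x m - x (m + 1)) = 0 := by
    refine Finset.sum_eq_zero fun m hm => ?_
    rw [ramp_eq_zero, zero_smul]
    refine le_trans ?_ hM
    have : (2 : ℝ) ^ (m + 1) ≤ 2 ^ M := pow_le_pow_right₀ one_le_two (Finset.mem_range.1 hm)
    nlinarith
  rw [polygon, ← (summable_ramp hs t).sum_add_tsum_nat_add (M + 1), Finset.sum_range_succ, hhead,
    htail, zero_add, segment_symm, segment_eq_image']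
  exact ⟨ramp M t, ⟨ramp_nonneg _ _, ramp_le_one _ _⟩, by simp only; abel⟩

theorem continuous_polygon (hs : Summable fun m => dist (x m) (x (m + 1))) :
    Continuous (polygon x q) := by
  refine continuous_const.add (continuous_tsum (fun m => ?_) hs fun m t => ?_)
  · exact (continuous_ramp m).smul continuous_const
  · rw [norm_smul, ← dist_eq_norm, Real.norm_of_nonneg (ramp_nonneg m t)]
    exact mul_le_of_le_one_left dist_nonneg (ramp_le_one m t)

/-- Each ramp increases from 0 to 1, so it has total variation 1, and the `m`-th summand contributes
at most the length of its segment. -/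
theorem eVariationOn_polygon_le (hs : Summable fun m => dist (x m) (x (m + 1))) :
    eVariationOn (polygon x q) (Icc 0 1) ≤ ENNReal.ofReal (∑' m, dist (x m) (x (m + 1))) := by
  have key (s t : ℝ) : edist (polygon x q s) (polygon x q t) ≤
      ∑' m, edist (ramp m s) (ramp m t) * edist (x m) (x (m + 1)) := by
    rw [polygon, polygon, edist_add_left, edist_eq_enorm_sub,
      ← (summable_ramp hs s).tsum_sub (summable_ramp hs t)]
    refine enorm_tsum_le_tsum_enorm.trans (le_of_eq (tsum_congr fun m => ?_))
    rw [← sub_smul, enorm_smul, edist_eq_enorm_sub, edist_eq_enorm_sub]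
  refine iSup_le fun ⟨n, u, hu, hmem⟩ => ?_
  calc ∑ i ∈ Finset.range n, edist (polygon x q (u (i + 1))) (polygon x q (u i))
      ≤ ∑ i ∈ Finset.range n, ∑' m, edist (ramp m (u (i + 1))) (ramp m (u i)) *
          edist (x m) (x (m + 1)) := Finset.sum_le_sum fun i _ => key _ _
    _ = ∑' m, (∑ i ∈ Finset.range n, edist (ramp m (u (i + 1))) (ramp m (u i))) *
          edist (x m) (x (m + 1)) := by
        rw [← Summable.tsum_finsetSum fun _ _ => ENNReal.summable]
        exact tsum_congr fun m => (Finset.sum_mul _ _ _).symm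
    _ ≤ ∑' m, edist (x m) (x (m + 1)) := by
        refine ENNReal.tsum_le_tsum fun m => mul_le_of_le_one_left' ?_
        refine (eVariationOn.sum_le hu hmem).trans ?_
        have := ((monotone_ramp m).monotoneOn (Icc 0 1)).eVariationOn_eq
          (left_mem_Icc.2 zero_le_one) (right_mem_Icc.2 zero_le_one)
        rw [inter_self] at this
        refine this.le.trans ?_
        rw [ramp_one, ramp_eq_zero (by simp)]
        simp
    _ = ENNReal.ofReal (∑' m, dist (x m) (x (m + 1))) := by
        rw [ENNReal.ofReal_tsum_of_nonneg (fun _ => dist_nonneg) hs]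
        simp_rw [edist_dist]

end Concatenation

theorem geodesicDist_le_tsum {x : ℕ → Plane} {p q : gasket} (h0 : x 0 = p)
    (hseg : ∀ m, segment ℝ (x m) (x (m + 1)) ⊆ gasket)
    (hs : Summable fun m => dist (x m) (x (m + 1))) (hq : Tendsto x atTop (𝓝 q)) :
    geodesicDist q p ≤ ENNReal.ofReal (∑' m, dist (x m) (x (m + 1))) := by
  have hmem (t : I) : polygon x q t ∈ gasket := by
    rcases t.2.1.eq_or_lt with h | h
    · rw [← h, polygon_zero]
      exact q.2
    · obtain ⟨M, hM⟩ := polygon_mem_segment hs hq h t.2.2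
      exact hseg M hM
  let γ : Path q p :=
    { toFun := fun t => ⟨polygon x q t, hmem t⟩
      continuous_toFun :=
        ((continuous_polygon hs).comp continuous_subtype_val).subtype_mk _
      source' := Subtype.ext (by simpa using polygon_zero)
      target' := Subtype.ext (by simpa [h0] using polygon_one hs hq) }
  refine (geodesicDist_le q p γ).trans (le_trans ?_ (eVariationOn_polygon_le (q := q) hs))
  have hm : Monotone (Subtype.val : I → ℝ) := fun _ _ h => h
  exact eVariationOn.comp_le_of_monotoneOn (polygon x q) _ (hm.monotoneOn univ) fun t _ => t.2

theorem geodesicDist_le_edist {p q : gasket} (h : segment ℝ (p : Plane) q ⊆ gasket) :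
    geodesicDist p q ≤ edist p q := by
  -- A single segment is a polygon that is constant after its first step.
  let x : ℕ → Plane := fun m => if m = 0 then q else p
  have hx : (fun m => dist (x m) (x (m + 1))) = Pi.single 0 (dist (q : Plane) p) := by
    ext m
    cases m <;> simp [x]
  have hsum : HasSum (fun m => dist (x m) (x (m + 1))) (dist (q : Plane) p) := by
    rw [hx]
    exact hasSum_pi_single 0 _
  have := geodesicDist_le_tsum (x := x) (p := q) (q := p) rfl (fun m => ?_) hsum.summable ?_
  · rwa [hsum.tsum_eq, ← edist_dist, edist_comm] at this
  · cases m with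
    | zero => simpa [x, segment_symm] using h
    | succ m => simp [x]
  · refine tendsto_const_nhds.congr' ?_
    filter_upwards [eventually_ne_atTop 0] with m hm
    simp [x, hm]

/-! ### Geodesic size of cells; finiteness and continuity of the distance. -/

theorem exists_nested_words {w : List (Fin 3)} {x : Plane} (hx : x ∈ gasket) (hw : x ∈ cell w) :
    ∃ s : ℕ → List (Fin 3), s 0 = w ∧ (∀ m, x ∈ cell (s m)) ∧ ∀ m, ∃ j, s (m + 1) = s m ++ [j] := by
  choose! next hnext using fun w => exists_mem_cell_append_singleton (w := w) hx
  let s : ℕ → List (Fin 3) := fun m => Nat.rec w (fun _ u => u ++ [next u]) m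
  refine ⟨s, rfl, fun m => ?_, fun m => ⟨next (s m), rfl⟩⟩
  induction m with
  | zero => exact hw
  | succ m ih => exact hnext _ ih

/-- The lower left vertices of nested cells around `x` converge to `x`. Passing to a child moves
such a vertex by at most half a side, along a side. The cruder bound by the whole side `2π/3 ·
radius` already gives a geometric series, with sum `4π/3 · radius w.length`. -/
theorem geodesicDist_vertex_le {w : List (Fin 3)} {x : gasket} (hw : (x : Plane) ∈ cell w) :
    geodesicDist x ⟨vertex w 2, vertex_mem_gasket w 2⟩ ≤
      ENNReal.ofReal (4 * Real.pi / 3 * radius w.length) := by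
  obtain ⟨s, hs0, hx, hs⟩ := exists_nested_words x.2 hw
  have hlen (m : ℕ) : (s m).length = w.length + m := by
    induction m with
    | zero => rw [hs0, add_zero]
    | succ m ih =>
      obtain ⟨j, hj⟩ := hs m
      rw [hj, List.length_append, ih, List.length_singleton, add_assoc]
  have hrad (m : ℕ) : radius (s m).length = radius w.length * (1 / 2) ^ m := by
    rw [hlen, radius, radius, pow_add, one_div]
  have hd (m : ℕ) : dist (vertex (s m) 2) (vertex (s (m + 1)) 2) ≤
      2 * Real.pi / 3 * radius w.length * (1 / 2) ^ m := by
    obtain ⟨j, hj⟩ := hs m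
    rw [hj, vertex_append_singleton, dist_comm, midpoint_comm, dist_midpoint_left]
    have h2 : ‖(2 : ℝ)‖⁻¹ ≤ 1 := by norm_num
    have hle : dist (vertex (s m) 2) (vertex (s m) j) ≤ side (s m).length := by
      by_cases h : (2 : Fin 3) = j
      · rw [h, dist_self]
        exact (side_pos _).le
      · exact (dist_vertex _ h).le
    refine (mul_le_of_le_one_left dist_nonneg h2).trans (hle.trans (le_of_eq ?_))
    rw [side, perimeter, hrad]
    ring
  have hgeo := (hasSum_geometric_two).mul_left (2 * Real.pi / 3 * radius w.length)
  have hsum : Summable fun m => dist (vertex (s m) 2) (vertex (s (m + 1)) 2) :=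
    Summable.of_nonneg_of_le (fun _ => dist_nonneg) hd hgeo.summable
  refine (geodesicDist_le_tsum (x := fun m => vertex (s m) 2) (by rw [hs0]) (fun m => ?_) hsum
    ?_).trans (ENNReal.ofReal_le_ofReal ?_)
  · obtain ⟨j, hj⟩ := hs m
    have := segment_vertex_subset (s m) 2 j
    refine subset_trans ?_ this
    rw [hj, vertex_append_singleton, midpoint_comm]
    exact (convex_segment _ _).segment_subset (left_mem_segment ℝ _ _) (midpoint_mem_segment _ _)
  · obtain ⟨R, -, hR⟩ := exists_dist_le_of_mem_cell
    rw [tendsto_iff_dist_tendsto_zero]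
    refine squeeze_zero (fun _ => dist_nonneg)
      (fun m => hR (s m) _ (vertex_mem_cell (s m) 2) _ (hx m)) ?_
    have : Tendsto (fun m => R * radius (s m).length) atTop (𝓝 (R * 0)) := by
      refine (tendsto_radius.comp ?_).const_mul R
      simp_rw [hlen]
      exact tendsto_atTop_mono (fun m => Nat.le_add_left m _) tendsto_id
    rwa [mul_zero] at this
  · refine (hsum.tsum_le_tsum hd hgeo.summable).trans (le_of_eq ?_)
    rw [hgeo.tsum_eq]
    ring

theorem geodesicDist_le_of_mem_cell {w : List (Fin 3)} {x y : gasket} (hx : (x : Plane) ∈ cell w)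
    (hy : (y : Plane) ∈ cell w) :
    geodesicDist x y ≤ ENNReal.ofReal (8 * Real.pi / 3 * radius w.length) := by
  refine (geodesicDist_triangle x ⟨vertex w 2, vertex_mem_gasket w 2⟩ y).trans ?_
  rw [geodesicDist_comm _ y]
  refine (add_le_add (geodesicDist_vertex_le hx) (geodesicDist_vertex_le hy)).trans (le_of_eq ?_)
  have := radius_pos w.length
  rw [← ENNReal.ofReal_add (by positivity) (by positivity)]
  ring_nf

theorem mem_cell_nil {x : Plane} (hx : x ∈ gasket) : x ∈ cell [] := by
  simpa using gasket_subset_cells 0 hx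

theorem geodesicDist_ne_top (p q : gasket) : geodesicDist p q ≠ ⊤ :=
  ne_top_of_le_ne_top ENNReal.ofReal_ne_top
    (geodesicDist_le_of_mem_cell (mem_cell_nil p.2) (mem_cell_nil q.2))

/-- Points near `x` share a cell of level `n` with `x`. -/
theorem eventually_exists_cell (x : gasket) (n : ℕ) :
    ∀ᶠ y : gasket in 𝓝 x, ∃ w : List (Fin 3), w.length = n ∧ (x : Plane) ∈ cell w ∧ (y : Plane) ∈ cell w := by
  have hc : IsClosed (⋃ w ∈ {w : List (Fin 3) | w.length = n ∧ (x : Plane) ∉ cell w}, cell w) :=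
    ((finite_words n).subset fun w hw => hw.1).isClosed_biUnion fun w _ => isClosed_cell w
  have hx : (x : Plane) ∈ (⋃ w ∈ {w : List (Fin 3) | w.length = n ∧ (x : Plane) ∉ cell w},
      cell w)ᶜ := by
    intro h
    obtain ⟨w, hw, hxw⟩ := mem_iUnion₂.1 h
    exact hw.2 hxw
  filter_upwards [continuous_subtype_val.continuousAt.eventually (hc.isOpen_compl.mem_nhds hx)]
    with y hy
  obtain ⟨w, hw, hyw⟩ := mem_iUnion₂.1 (gasket_subset_cells n y.2)
  refine ⟨w, hw, ?_, hyw⟩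
  by_contra hxw
  exact hy (mem_iUnion₂.2 ⟨w, ⟨hw, hxw⟩, hyw⟩)

theorem abs_geodesicDist_sub_le (p x y : gasket) :
    |(geodesicDist p x).toReal - (geodesicDist p y).toReal| ≤ (geodesicDist x y).toReal := by
  have h (x y : gasket) :
      (geodesicDist p x).toReal - (geodesicDist p y).toReal ≤ (geodesicDist x y).toReal := by
    have := ENNReal.toReal_mono (ENNReal.add_ne_top.2 ⟨geodesicDist_ne_top p y,
      geodesicDist_ne_top y x⟩) (geodesicDist_triangle p y x)
    rw [ENNReal.toReal_add (geodesicDist_ne_top p y) (geodesicDist_ne_top y x),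
      geodesicDist_comm y x] at this
    linarith
  rw [abs_le]
  constructor
  · have := h y x
    rw [geodesicDist_comm y x] at this
    linarith
  · exact h x y

/-- Points near `x` share a cell of level `n` with `x`, and the geodesic diameter of such a cell
tends to 0. -/
theorem continuous_geodesicDist (p : gasket) :
    Continuous fun x => (geodesicDist p x).toReal := by
  rw [continuous_iff_continuousAt]
  intro x
  rw [Metric.continuousAt_iff']
  intro ε hε
  have ht : Tendsto (fun n => 8 * Real.pi / 3 * radius n) atTop (𝓝 0) := by
    simpa using tendsto_radius.const_mul (8 * Real.pi / 3)
  obtain ⟨n, hn⟩ := (ht.eventually_lt_const hε).exists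
  filter_upwards [eventually_exists_cell x n] with y hy
  obtain ⟨w, rfl, hxw, hyw⟩ := hy
  have := radius_pos w.length
  rw [Real.dist_eq]
  refine (abs_geodesicDist_sub_le p y x).trans_lt (lt_of_le_of_lt ?_ hn)
  exact ENNReal.toReal_le_of_le_ofReal (by positivity) (geodesicDist_le_of_mem_cell hyw hxw)

end Paths

/-! ### Functions that are contracting on the vertices contract lengths of curves -/

section Contracting

variable {p q : gasket}

/-- Here `t₁` is the last time in a cell `w` that contains `γ t₀`. Since `w` is never visited again,
it can be removed from the list of cells available to the rest of the curve; this makes the later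
induction terminate. -/
theorem exists_last_exit (γ : Path p q) (s : Finset (List (Fin 3))) {n : ℕ}
    (hn : ∀ w ∈ s, w.length = n) (t₀ : I) (hcov : ∀ t, t₀ ≤ t → ∃ w ∈ s, (γ t : Plane) ∈ cell w) :
    ∃ w ∈ s, ∃ t₁, t₀ ≤ t₁ ∧ (γ t₀ : Plane) ∈ cell w ∧ (γ t₁ : Plane) ∈ cell w ∧
      (t₁ = 1 ∨ (∃ j, (γ t₁ : Plane) = vertex w j) ∧
        ∀ t, t₁ ≤ t → ∃ u ∈ s.erase w, (γ t : Plane) ∈ cell u) := by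
  obtain ⟨w, hws, hw⟩ := hcov t₀ le_rfl
  have hcont : Continuous fun t : I => (γ t : Plane) :=
    continuous_subtype_val.comp γ.continuous
  have hA : IsCompact (Ici t₀ ∩ (fun t : I => (γ t : Plane)) ⁻¹' cell w) :=
    (isClosed_Ici.inter ((isClosed_cell w).preimage hcont)).isCompact
  obtain ⟨t₁, ⟨h01, h1⟩, hmax⟩ := hA.exists_isGreatest ⟨t₀, self_mem_Ici, hw⟩
  refine ⟨w, hws, t₁, h01, hw, h1, ?_⟩
  rcases (unitInterval.le_one' : t₁ ≤ 1).eq_or_lt with h | h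
  · exact Or.inl h
  right
  have hclosed : IsClosed {t : I | ∃ u ∈ s.erase w, (γ t : Plane) ∈ cell u} := by
    have e : {t : I | ∃ u ∈ s.erase w, (γ t : Plane) ∈ cell u} =
        ⋃ u ∈ s.erase w, (fun t : I => (γ t : Plane)) ⁻¹' cell u := by
      ext t
      simp
    rw [e]
    exact isClosed_biUnion_finset fun u _ => (isClosed_cell u).preimage hcont
  have hrest : ∀ t, t₁ ≤ t → ∃ u ∈ s.erase w, (γ t : Plane) ∈ cell u := by
    have hsub : Ioi t₁ ⊆ {t : I | ∃ u ∈ s.erase w, (γ t : Plane) ∈ cell u} := by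
      intro t ht
      obtain ⟨u, hu, hut⟩ := hcov t (h01.trans (le_of_lt ht))
      refine ⟨u, Finset.mem_erase.2 ⟨?_, hu⟩, hut⟩
      rintro rfl
      exact (hmax ⟨mem_Ici.2 ((mem_Ici.1 h01).trans (le_of_lt ht)), hut⟩).not_gt ht
    -- The other cells cover the curve at all times after `t₁`. They are finitely many and closed,
    -- so they also cover it at `t₁`, where the curve therefore lies in two distinct cells.
    have hcl := closure_minimal hsub hclosed
    rw [closure_Ioi' (a := t₁) ⟨1, h⟩] at hcl
    exact fun t ht => hcl ht
  refine ⟨?_, hrest⟩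
  obtain ⟨u, hu, hut⟩ := hrest t₁ le_rfl
  obtain ⟨huw, hus⟩ := Finset.mem_erase.1 hu
  exact exists_eq_vertex ((hn w hws).trans (hn u hus).symm) (Ne.symm huw) h1 hut

variable {f : C(gasket, ℂ)}

theorem edist_apply_le_of_vertex
    (hf : ∀ w i j, dist (f ⟨vertex w i, vertex_mem_gasket w i⟩)
      (f ⟨vertex w j, vertex_mem_gasket w j⟩) ≤ side w.length) {w : List (Fin 3)} {i j : Fin 3}
    {x y : gasket} (hx : (x : Plane) = vertex w i) (hy : (y : Plane) = vertex w j) :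
    edist (f x) (f y) ≤ edist x y := by
  obtain rfl : x = ⟨vertex w i, vertex_mem_gasket w i⟩ := Subtype.ext hx
  obtain rfl : y = ⟨vertex w j, vertex_mem_gasket w j⟩ := Subtype.ext hy
  by_cases hij : i = j
  · subst hij
    simp
  · rw [edist_dist, edist_dist]
    exact ENNReal.ofReal_le_ofReal ((hf w i j).trans (dist_vertex w hij).ge)

/-- Induction on the set of cells still available to a curve that starts at a vertex. Up to the last
exit from the current cell, `f` changes by at most the chord between two vertices. The error `ε`
arises only once, in the cell where the curve ends. -/
theorem edist_le_eVariationOn_Icc_add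
    (hf : ∀ w i j, dist (f ⟨vertex w i, vertex_mem_gasket w i⟩)
      (f ⟨vertex w j, vertex_mem_gasket w j⟩) ≤ side w.length) (γ : Path p q) {n : ℕ} {ε : ℝ≥0∞}
    (hε : ∀ w : List (Fin 3), w.length = n → ∀ x y : gasket, (x : Plane) ∈ cell w →
      (y : Plane) ∈ cell w → edist (f x) (f y) ≤ ε)
    (s : Finset (List (Fin 3))) (hn : ∀ w ∈ s, w.length = n) (t₀ : I)
    (hcov : ∀ t, t₀ ≤ t → ∃ w ∈ s, (γ t : Plane) ∈ cell w)
    (hv : ∃ w : List (Fin 3), w.length = n ∧ ∃ j, (γ t₀ : Plane) = vertex w j) :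
    edist (f (γ t₀)) (f q) ≤ eVariationOn γ (Icc t₀ 1) + ε := by
  induction s using Finset.strongInduction generalizing t₀ with
  | H s ih =>
    obtain ⟨w, hws, t₁, h01, hw0, hw1, h⟩ := exists_last_exit γ s hn t₀ hcov
    rcases h with rfl | ⟨⟨j, hj⟩, hrest⟩
    · rw [γ.target] at hw1
      exact (hε w (hn w hws) _ _ hw0 hw1).trans le_add_self
    · have hi : ∃ i, (γ t₀ : Plane) = vertex w i := by
        obtain ⟨u, hu, i, hi⟩ := hv
        by_cases huw : u = w
        · exact ⟨i, huw ▸ hi⟩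
        · exact exists_eq_vertex ((hn w hws).trans hu.symm) (Ne.symm huw) hw0
            (hi ▸ vertex_mem_cell u i)
      obtain ⟨i, hi⟩ := hi
      have hIH := ih (s.erase w) (Finset.erase_ssubset hws)
        (fun u hu => hn u (Finset.mem_of_mem_erase hu)) t₁ hrest ⟨w, hn w hws, j, hj⟩
      have hsplit := eVariationOn.Icc_add_Icc γ h01 (unitInterval.le_one' : t₁ ≤ 1) (mem_univ t₁)
      simp only [univ_inter] at hsplit
      rw [← hsplit, add_assoc]
      refine (edist_triangle _ (f (γ t₁)) _).trans (add_le_add ?_ hIH)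
      exact (edist_apply_le_of_vertex hf hi hj).trans
        (eVariationOn.edist_le γ (left_mem_Icc.2 h01) (right_mem_Icc.2 h01))

theorem edist_le_eVariationOn_add
    (hf : ∀ w i j, dist (f ⟨vertex w i, vertex_mem_gasket w i⟩)
      (f ⟨vertex w j, vertex_mem_gasket w j⟩) ≤ side w.length) (γ : Path p q) {n : ℕ} {ε : ℝ≥0∞}
    (hε : ∀ w : List (Fin 3), w.length = n → ∀ x y : gasket, (x : Plane) ∈ cell w →
      (y : Plane) ∈ cell w → edist (f x) (f y) ≤ ε) :
    edist (f p) (f q) ≤ ε + (eVariationOn γ univ + ε) := by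
  have hn : ∀ w ∈ (finite_words n).toFinset, w.length = n := fun w hw => by simpa using hw
  obtain ⟨w, hws, t₁, -, hw0, hw1, h⟩ := exists_last_exit γ (finite_words n).toFinset hn 0
    (fun t _ => by simpa using gasket_subset_cells n (γ t).2)
  rw [γ.source] at hw0
  rcases h with rfl | ⟨⟨j, hj⟩, hrest⟩
  · rw [γ.target] at hw1
    exact (hε w (hn w hws) _ _ hw0 hw1).trans le_self_add
  · refine (edist_triangle _ (f (γ t₁)) _).trans
      (add_le_add (hε w (hn w hws) _ _ hw0 hw1) ?_)
    refine (edist_le_eVariationOn_Icc_add hf γ hε _ (fun u hu =>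
      hn u (Finset.mem_of_mem_erase hu)) t₁ hrest ⟨w, hn w hws, j, hj⟩).trans ?_
    gcongr
    exact eVariationOn.mono _ (subset_univ _)

theorem edist_le_eVariationOn
    (hf : ∀ w i j, dist (f ⟨vertex w i, vertex_mem_gasket w i⟩)
      (f ⟨vertex w j, vertex_mem_gasket w j⟩) ≤ side w.length) (γ : Path p q) :
    edist (f p) (f q) ≤ eVariationOn γ univ := by
  refine ENNReal.le_of_forall_pos_le_add fun ε hε _ => ?_
  have huc := CompactSpace.uniformContinuous_of_continuous f.continuous
  obtain ⟨δ, hδ, hfδ⟩ := Metric.uniformContinuous_iff.1 huc (ε / 2) (by positivity)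
  obtain ⟨R, -, hR⟩ := exists_dist_le_of_mem_cell
  have ht : Filter.Tendsto (fun n => R * radius n) Filter.atTop (nhds 0) := by
    simpa using tendsto_radius.const_mul R
  obtain ⟨n, hn⟩ := (ht.eventually_lt_const hδ).exists
  have key := edist_le_eVariationOn_add hf γ (n := n) (ε := (ε / 2 : ℝ≥0))
    fun w hw x y hx hy => by
      rw [edist_le_coe, ← NNReal.coe_le_coe, coe_nndist, NNReal.coe_div]
      refine (hfδ ?_).le
      exact (hR w _ hx _ hy).trans_lt (hw ▸ hn)
  refine key.trans (le_of_eq ?_)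
  rw [add_comm, add_assoc, ← ENNReal.coe_add, add_halves]

end Contracting

/-! ### Commutators with a diagonal operator and the unitary group that it generates -/

section UnitaryGroup

open Filter Topology

variable {ι E : Type*} [NormedAddCommGroup E] [InnerProductSpace ℂ E]
  {b : HilbertBasis ι ℂ E} {lam : ι → ℝ}

local notation "⟪" x ", " y "⟫" => inner ℂ x y

theorem mem_domain_diagonalOperator {x : E} :
    x ∈ (diagonalOperator b lam).domain ↔ Memℓp (fun i => (lam i : ℂ) * b.repr x i) 2 := Iff.rfl

theorem repr_diagonalOperator (x : (diagonalOperator b lam).domain) (i : ι) :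
    b.repr (diagonalOperator b lam x) i = lam i * b.repr (x : E) i := by
  change b.repr (b.repr.symm ⟨fun i => (lam i : ℂ) * b.repr (x : E) i, x.2⟩) i = _
  rw [LinearIsometryEquiv.apply_symm_apply]

theorem ext_repr (b : HilbertBasis ι ℂ E) {x y : E} (h : ∀ i, b.repr x i = b.repr y i) : x = y :=
  b.repr.injective (by ext i; exact h i)

theorem hasSum_sq_norm_repr (b : HilbertBasis ι ℂ E) (x : E) :
    HasSum (fun i => ‖b.repr x i‖ ^ 2) (‖x‖ ^ 2) := by
  have := lp.hasSum_norm (p := 2) (by norm_num) (b.repr x)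
  simpa using this

theorem inner_diagonalOperator (x y : (diagonalOperator b lam).domain) :
    ⟪diagonalOperator b lam x, (y : E)⟫ = ⟪(x : E), diagonalOperator b lam y⟫ := by
  rw [← b.repr.inner_map_map, ← b.repr.inner_map_map, lp.inner_eq_tsum, lp.inner_eq_tsum]
  refine tsum_congr fun i => ?_
  rw [repr_diagonalOperator, repr_diagonalOperator]
  simp only [RCLike.inner_apply, map_mul, Complex.conj_ofReal]
  ring

theorem dense_domain_diagonalOperator : Dense ((diagonalOperator b lam).domain : Set E) := by
  classical
  have hle : Submodule.span ℂ (range b) ≤ (diagonalOperator b lam).domain := by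
    rw [Submodule.span_le]
    rintro _ ⟨j, rfl⟩
    refine mem_domain_diagonalOperator.2 ?_
    have e : (fun i => (lam i : ℂ) * b.repr (b j) i) = (lam j : ℂ) • ⇑(b.repr (b j)) := by
      ext i
      rw [b.repr_self, Pi.smul_apply, smul_eq_mul]
      by_cases h : i = j
      · rw [h]
      · rw [lp.single_apply_ne _ _ _ h, mul_zero, mul_zero]
    rw [e]
    exact (lp.memℓp _).const_smul _
  exact (Submodule.dense_iff_topologicalClosure_eq_top.2 b.dense_span).mono hle

/-- `U` is the one-parameter group `exp (i t D)` of the diagonal operator `D`. -/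
def IsUnitaryGroup (b : HilbertBasis ι ℂ E) (lam : ι → ℝ) (U : ℝ → E →ₗᵢ[ℂ] E) : Prop :=
  ∀ t x i, b.repr (U t x) i = Complex.exp (Complex.I * (t * lam i : ℝ)) * b.repr x i

variable {U : ℝ → E →ₗᵢ[ℂ] E}

namespace IsUnitaryGroup

theorem zero (hU : IsUnitaryGroup b lam U) (x : E) : U 0 x = x :=
  ext_repr b fun i => by simp [hU 0 x i]

theorem add (hU : IsUnitaryGroup b lam U) (s t : ℝ) (x : E) : U (s + t) x = U s (U t x) :=
  ext_repr b fun i => by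
    rw [hU, hU, hU, ← mul_assoc, ← Complex.exp_add]
    congr 2
    push_cast
    ring

theorem inner_neg (hU : IsUnitaryGroup b lam U) (t : ℝ) (x y : E) : ⟪U (-t) x, y⟫ = ⟪x, U t y⟫ := by
  rw [← (U t).inner_map_map, ← hU.add, add_neg_cancel, hU.zero]

theorem mem_domain (hU : IsUnitaryGroup b lam U) (t : ℝ) {x : E}
    (hx : x ∈ (diagonalOperator b lam).domain) : U t x ∈ (diagonalOperator b lam).domain := by
  refine mem_domain_diagonalOperator.2 ((mem_domain_diagonalOperator.1 hx).mono' fun i => ?_)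
  rw [hU, norm_mul, norm_mul, norm_mul, mul_comm Complex.I, Complex.norm_exp_ofReal_mul_I, one_mul]

theorem diagonalOperator_apply (hU : IsUnitaryGroup b lam U) (t : ℝ)
    (x : (diagonalOperator b lam).domain) :
    diagonalOperator b lam ⟨U t x, hU.mem_domain t x.2⟩ = U t (diagonalOperator b lam x) :=
  ext_repr b fun i => by
    rw [repr_diagonalOperator, hU, hU, repr_diagonalOperator]
    ring

theorem repr_slope (hU : IsUnitaryGroup b lam U) (x : E) (h : ℝ) (i : ι) :
    b.repr (h⁻¹ • (U h x - x)) i =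
      (h : ℂ)⁻¹ * (Complex.exp (Complex.I * (h * lam i : ℝ)) - 1) * b.repr x i := by
  rw [← Complex.coe_smul, map_smul, lp.coeFn_smul, Pi.smul_apply, map_sub, lp.coeFn_sub,
    Pi.sub_apply, hU, smul_eq_mul, Complex.ofReal_inv]
  ring

theorem tendsto_exp_slope (r : ℝ) :
    Tendsto (fun h : ℝ => (h : ℂ)⁻¹ * (Complex.exp (Complex.I * (h * r : ℝ)) - 1)) (𝓝[≠] 0)
      (𝓝 (Complex.I * r)) := by
  have h : HasDerivAt (fun h : ℝ => Complex.exp (Complex.I * (h * r : ℝ))) (Complex.I * r) 0 := by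
    have h1 : HasDerivAt (fun h : ℝ => Complex.I * (h * r : ℝ)) (Complex.I * r) 0 := by
      have := ((hasDerivAt_id (0 : ℝ)).mul_const r).ofReal_comp.const_mul Complex.I
      simpa using this
    simpa using h1.cexp
  have := h.tendsto_slope_zero
  refine this.congr fun h => ?_
  rw [← Complex.coe_smul, smul_eq_mul, Complex.ofReal_inv]
  simp

theorem norm_exp_slope_le (h r : ℝ) :
    ‖(h : ℂ)⁻¹ * (Complex.exp (Complex.I * (h * r : ℝ)) - 1)‖ ≤ |r| := by
  rcases eq_or_ne h 0 with rfl | hh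
  · simp
  · rw [norm_mul, norm_inv, Complex.norm_real, inv_mul_le_iff₀ (norm_pos_iff.2 hh)]
    exact (Real.norm_exp_I_mul_ofReal_sub_one_le).trans (by rw [norm_mul, Real.norm_eq_abs r])

/-- By Parseval, the squared norm of the error is a sum over the coordinates. Each term tends to 0
and is at most `(2 |lam i| ‖b.repr x i‖)²`, which is summable for `x` in the domain, so dominated
convergence applies. -/
theorem tendsto_slope (hU : IsUnitaryGroup b lam U) (x : (diagonalOperator b lam).domain) :
    Tendsto (fun h : ℝ => h⁻¹ • (U h x - (x : E))) (𝓝[≠] 0)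
      (𝓝 (Complex.I • diagonalOperator b lam x)) := by
  rw [tendsto_iff_norm_sub_tendsto_zero]
  have hrepr (h : ℝ) (i : ι) :
      b.repr (h⁻¹ • (U h x - (x : E)) - Complex.I • diagonalOperator b lam x) i =
        ((h : ℂ)⁻¹ * (Complex.exp (Complex.I * (h * lam i : ℝ)) - 1) - Complex.I * lam i) *
          b.repr (x : E) i := by
    rw [map_sub, lp.coeFn_sub, Pi.sub_apply, hU.repr_slope, map_smul, lp.coeFn_smul,
      Pi.smul_apply, repr_diagonalOperator, smul_eq_mul]
    ring
  have hsq : Tendsto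
      (fun h : ℝ => ‖h⁻¹ • (U h x - (x : E)) - Complex.I • diagonalOperator b lam x‖ ^ 2)
      (𝓝[≠] 0) (𝓝 0) := by
    simp_rw [← fun y : E => (hasSum_sq_norm_repr b y).tsum_eq]
    suffices h : Tendsto (fun h : ℝ => ∑' i, ‖b.repr (h⁻¹ • (U h x - (x : E)) -
        Complex.I • diagonalOperator b lam x) i‖ ^ 2) (𝓝[≠] 0) (𝓝 (∑' _ : ι, 0)) by
      rwa [tsum_zero] at h
    refine tendsto_tsum_of_dominated_convergence
      (bound := fun i => 4 * ‖b.repr (diagonalOperator b lam x) i‖ ^ 2)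
      ((hasSum_sq_norm_repr b _).summable.mul_left 4) (fun i => ?_) (Eventually.of_forall fun h i => ?_)
    · simp_rw [hrepr]
      have h0 := (((tendsto_exp_slope (lam i)).sub_const (Complex.I * lam i)).mul_const
        (b.repr (x : E) i)).norm.pow 2
      simpa using h0
    · rw [Real.norm_of_nonneg (by positivity), hrepr, repr_diagonalOperator, norm_mul, norm_mul,
        Complex.norm_real, Real.norm_eq_abs]
      have h1 : ‖(h : ℂ)⁻¹ * (Complex.exp (Complex.I * (h * lam i : ℝ)) - 1) -
          Complex.I * lam i‖ ≤ 2 * |lam i| := by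
        refine (norm_sub_le _ _).trans ?_
        rw [norm_mul Complex.I, Complex.norm_I, one_mul, Complex.norm_real, Real.norm_eq_abs]
        linarith [norm_exp_slope_le h (lam i)]
      calc _ ≤ (2 * |lam i| * ‖b.repr (x : E) i‖) ^ 2 := by gcongr
        _ = _ := by ring
  have := hsq.sqrt
  simpa [Real.sqrt_sq] using this

theorem hasDerivAt (hU : IsUnitaryGroup b lam U) (x : (diagonalOperator b lam).domain) (t : ℝ) :
    HasDerivAt (fun t => U t x) (Complex.I • U t (diagonalOperator b lam x)) t := by
  rw [hasDerivAt_iff_tendsto_slope_zero, ← map_smul]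
  refine (((U t).continuous.tendsto _).comp (hU.tendsto_slope x)).congr fun h => ?_
  rw [Function.comp_apply, hU.add, ← Complex.coe_smul, map_smul, map_sub, Complex.coe_smul]

/-- Bounded difference quotients characterize the domain of the generator. -/
theorem mem_domain_of_norm_slope_le (hU : IsUnitaryGroup b lam U) {x : E} {h : ℕ → ℝ}
    (hh : Tendsto h atTop (𝓝[≠] 0)) {C : ℝ} (hC : ∀ n, ‖(h n)⁻¹ • (U (h n) x - x)‖ ≤ C) :
    x ∈ (diagonalOperator b lam).domain := by
  refine mem_domain_diagonalOperator.2 ?_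
  have hm : Memℓp (fun i => Complex.I * lam i * b.repr x i) 2 := by
    -- A pointwise limit of a bounded sequence in `ℓ²` lies in `ℓ²`.
    refine lp.memℓp_of_tendsto (l := atTop)
      (F := fun n => b.repr ((h n)⁻¹ • (U (h n) x - x))) ?_ ?_
    · refine isBounded_iff_forall_norm_le.2 ⟨C, ?_⟩
      rintro _ ⟨n, rfl⟩
      rw [LinearIsometryEquiv.norm_map]
      exact hC n
    · rw [tendsto_pi_nhds]
      intro i
      exact (((tendsto_exp_slope (lam i)).comp hh).mul_const _).congr
        fun n => (hU.repr_slope x (h n) i).symm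
  refine hm.mono' fun i => ?_
  rw [norm_mul, norm_mul, norm_mul, Complex.norm_I, one_mul]

/-- The function `s ↦ ⟪U (s - t) y, A (U s x)⟫` takes the values `⟪y, U t (A x)⟫` at `s = 0` and
`⟪y, A (U t x)⟫` at `s = t`. By symmetry of `D`, its derivative is `-i ⟪U (s - t) y, [D, A] U s x⟫`,
and the mean value inequality gives the factor `|t|`. -/
theorem norm_commutator_le_of_mem_domain (hU : IsUnitaryGroup b lam U) {A : E →L[ℂ] E}
    (hA : CommutatorNormLE (diagonalOperator b lam) A 1) (t : ℝ)
    (x : (diagonalOperator b lam).domain) :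
    ‖A (U t x) - U t (A x)‖ ≤ |t| * ‖(x : E)‖ := by
  obtain ⟨hdom, hle⟩ := hA
  have key (y : (diagonalOperator b lam).domain) :
      ‖⟪(y : E), A (U t x) - U t (A x)⟫‖ ≤ ‖(x : E)‖ * ‖(y : E)‖ * ‖t - 0‖ := by
    have hder (s : ℝ) : HasDerivAt (fun s => ⟪U (s - t) y, A (U s x)⟫)
        (⟪U (s - t) y, A (Complex.I • U s (diagonalOperator b lam x))⟫ +
          ⟪Complex.I • U (s - t) (diagonalOperator b lam y), A (U s x)⟫) s := by
      have h1 : HasDerivAt (fun s => A (U s x))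
          (A (Complex.I • U s (diagonalOperator b lam x))) s :=
        (A.restrictScalars ℝ).hasFDerivAt.comp_hasDerivAt s (hU.hasDerivAt x s)
      have h2 : HasDerivAt (fun s => U (s - t) y)
          (Complex.I • U (s - t) (diagonalOperator b lam y)) s := by
        have := (hU.hasDerivAt y (s - t)).scomp s ((hasDerivAt_id s).sub_const t)
        simpa [Function.comp_def] using this
      exact h2.inner ℂ h1
    have hbound (s : ℝ) : ‖⟪U (s - t) y, A (Complex.I • U s (diagonalOperator b lam x))⟫ +
          ⟪Complex.I • U (s - t) (diagonalOperator b lam y), A (U s x)⟫‖ ≤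
          ‖(x : E)‖ * ‖(y : E)‖ := by
      have hx' := hU.mem_domain s x.2
      have hy' := hU.mem_domain (s - t) y.2
      have e : ⟪U (s - t) y, A (Complex.I • U s (diagonalOperator b lam x))⟫ +
          ⟪Complex.I • U (s - t) (diagonalOperator b lam y), A (U s x)⟫ =
          -Complex.I * ⟪U (s - t) y, diagonalOperator b lam ⟨A (U s x), hdom _ hx'⟩ -
            A (diagonalOperator b lam ⟨U s x, hx'⟩)⟫ := by
        rw [inner_sub_right, ← inner_diagonalOperator ⟨U (s - t) y, hy'⟩ ⟨A (U s x), hdom _ hx'⟩,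
          hU.diagonalOperator_apply s x, hU.diagonalOperator_apply (s - t) y, map_smul,
          inner_smul_right, inner_smul_left, Complex.conj_I]
        ring
      rw [e, norm_mul, norm_neg, Complex.norm_I, one_mul, mul_comm]
      refine (norm_inner_le_norm _ _).trans ?_
      rw [(U (s - t)).norm_map]
      refine mul_le_mul_of_nonneg_left ?_ (norm_nonneg _)
      have := hle ⟨U s x, hx'⟩
      rwa [one_mul, (U s).norm_map] at this
    have hmv := convex_univ.norm_image_sub_le_of_norm_hasDerivWithin_le (x := 0) (y := t)
      (fun s _ => (hder s).hasDerivWithinAt) (fun s _ => hbound s) (mem_univ _) (mem_univ _)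
    rwa [sub_self, hU.zero, hU.zero, zero_sub, hU.inner_neg, ← inner_sub_right] at hmv
  set v := A (U t x) - U t (A x)
  have hclosed : IsClosed {y : E | ‖⟪y, v⟫‖ ≤ ‖(x : E)‖ * ‖y‖ * ‖t - 0‖} :=
    isClosed_le (by fun_prop) (by fun_prop)
  -- The estimate extends from the dense domain to all `y`, in particular to `y = v`.
  have hv : ‖⟪v, v⟫‖ ≤ ‖(x : E)‖ * ‖v‖ * ‖t - 0‖ := by
    have hsub := closure_minimal (fun y hy => key ⟨y, hy⟩) hclosed
    rw [(dense_domain_diagonalOperator (b := b) (lam := lam)).closure_eq] at hsub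
    exact hsub (mem_univ v)
  rw [inner_self_eq_norm_sq_to_K, sub_zero, Real.norm_eq_abs] at hv
  rcases (norm_nonneg v).eq_or_lt with h0 | h0
  · rw [← h0]
    positivity
  · refine le_of_mul_le_mul_left ?_ h0
    have : ‖((‖v‖ : ℂ)) ^ 2‖ = ‖v‖ * ‖v‖ := by
      rw [norm_pow, Complex.norm_real, norm_norm, sq]
    calc ‖v‖ * ‖v‖ = _ := this.symm
      _ ≤ _ := hv
      _ = _ := by ring

theorem norm_commutator_le (hU : IsUnitaryGroup b lam U) {A : E →L[ℂ] E}
    (hA : CommutatorNormLE (diagonalOperator b lam) A 1) (t : ℝ) (x : E) :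
    ‖A (U t x) - U t (A x)‖ ≤ |t| * ‖x‖ := by
  have hclosed : IsClosed {x : E | ‖A (U t x) - U t (A x)‖ ≤ |t| * ‖x‖} := by
    have := (U t).continuous
    exact isClosed_le (by fun_prop) (by fun_prop)
  have hsub := closure_minimal
    (fun x hx => hU.norm_commutator_le_of_mem_domain hA t ⟨x, hx⟩) hclosed
  rw [(dense_domain_diagonalOperator (b := b) (lam := lam)).closure_eq] at hsub
  exact hsub (mem_univ x)

/-- The quotient of `[U h, A] x` by `h` is the difference quotient of `A x` minus `A` applied to
that of `x`. If `x` is in the domain, the latter converges, so the difference quotients of `A x` are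
bounded and `A x` is in the domain. The norm bound follows in the limit. -/
theorem commutatorNormLE (hU : IsUnitaryGroup b lam U) {A : E →L[ℂ] E} {δ : ℝ} (hδ : 0 < δ)
    (hA : ∀ h, 0 < h → h < δ → ∀ x, ‖U h (A x) - A (U h x)‖ ≤ h * ‖x‖) :
    CommutatorNormLE (diagonalOperator b lam) A 1 := by
  -- The summand 2 keeps `h 0` strictly below `δ`.
  set h : ℕ → ℝ := fun n => δ / (n + 2) with hdef
  have hpos (n : ℕ) : 0 < h n := by positivity
  have hlt (n : ℕ) : h n < δ := div_lt_self hδ (by linarith [n.cast_nonneg (α := ℝ)])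
  have hlim : Tendsto h atTop (𝓝[≠] 0) := by
    refine tendsto_nhdsWithin_iff.2 ⟨?_, Eventually.of_forall fun n => (hpos n).ne'⟩
    exact tendsto_const_nhds.div_atTop
      (tendsto_atTop_add_const_right _ _ tendsto_natCast_atTop_atTop)
  have e (n : ℕ) (x : E) : (h n)⁻¹ • (U (h n) (A x) - A (U (h n) x)) =
      (h n)⁻¹ • (U (h n) (A x) - A x) - A ((h n)⁻¹ • (U (h n) x - x)) := by
    rw [← Complex.coe_smul, ← Complex.coe_smul, ← Complex.coe_smul, map_smul, map_sub, ← smul_sub]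
    congr 1
    abel
  have hle (n : ℕ) (x : E) : ‖(h n)⁻¹ • (U (h n) (A x) - A (U (h n) x))‖ ≤ ‖x‖ := by
    rw [norm_smul, norm_inv, Real.norm_of_nonneg (hpos n).le, inv_mul_le_iff₀ (hpos n)]
    exact hA _ (hpos n) (hlt n) x
  have hdom (x : E) (hx : x ∈ (diagonalOperator b lam).domain) :
      A x ∈ (diagonalOperator b lam).domain := by
    have ht := ((A.continuous.tendsto _).comp ((hU.tendsto_slope ⟨x, hx⟩).comp hlim))
    obtain ⟨C, hC⟩ := ht.norm.bddAbove_range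
    refine hU.mem_domain_of_norm_slope_le hlim (C := ‖x‖ + C) fun n => ?_
    rw [eq_add_of_sub_eq (e n x).symm]
    exact (norm_add_le _ _).trans (add_le_add (hle n x) (hC ⟨n, rfl⟩))
  refine ⟨hdom, fun x => ?_⟩
  have ht := ((hU.tendsto_slope ⟨A x, hdom x x.2⟩).comp hlim).sub
    ((A.continuous.tendsto _).comp ((hU.tendsto_slope x).comp hlim))
  rw [map_smul, ← smul_sub] at ht
  have hnorm := le_of_tendsto' ht.norm fun n => (congrArg norm (e n x)).symm.trans_le (hle n x)
  rwa [norm_smul, Complex.norm_I, one_mul, ← one_mul ‖(x : E)‖] at hnorm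

end IsUnitaryGroup

end UnitaryGroup

/-! ### Commutators with direct sums of operators -/

section DirectSumCommutator

variable {ι : Type*} {E : ι → Type*} [∀ i, NormedAddCommGroup (E i)]
  [∀ i, InnerProductSpace ℂ (E i)]

theorem LinearPMap_congr {F : Type*} [NormedAddCommGroup F] [NormedSpace ℂ F] (f : F →ₗ.[ℂ] F)
    {x y : F} (h : x = y) (hx : x ∈ f.domain) (hy : y ∈ f.domain) : f ⟨x, hx⟩ = f ⟨y, hy⟩ := by
  subst h
  rfl

/-- The commutator is tested on vectors supported in the single summand `i`. -/
theorem commutatorNormLE_of_directSum {D : ∀ i, E i →ₗ.[ℂ] E i} {T : ∀ i, E i →L[ℂ] E i} {C : ℝ}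
    {hC : 0 ≤ C} {hT : ∀ i, ‖T i‖ ≤ C}
    (h : CommutatorNormLE (directSumOperator D) (directSumBounded T C hC hT) 1) (i : ι) :
    CommutatorNormLE (D i) (T i) 1 := by
  classical
  obtain ⟨hdom, hle⟩ := h
  have hcomp (x : (D i).domain) (j : ι) : lp.single 2 i (x : E i) j ∈ (D j).domain := by
    by_cases hj : j = i
    · subst hj
      rw [lp.single_apply_self]
      exact x.2
    · rw [lp.single_apply_ne _ _ _ hj]
      exact (D j).domain.zero_mem
  have happ (x : (D i).domain) (j : ι) :
      D j ⟨lp.single 2 i (x : E i) j, hcomp x j⟩ = lp.single 2 i (D i x) j := by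
    by_cases hj : j = i
    · subst hj
      exact (LinearPMap_congr _ (lp.single_apply_self _ _ _) _ x.2).trans
        (lp.single_apply_self _ _ _).symm
    · exact (LinearPMap_congr _ (lp.single_apply_ne _ _ _ hj) _ (D j).domain.zero_mem).trans
        ((D j).map_zero.trans (lp.single_apply_ne _ _ _ hj).symm)
  have hmem (x : (D i).domain) : lp.single 2 i (x : E i) ∈ (directSumOperator D).domain := by
    refine ⟨hcomp x, ?_⟩
    rw [funext (happ x)]
    exact lp.memℓp _
  have hTx (x : E i) : directSumBounded T C hC hT (lp.single 2 i x) i = T i x := by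
    change T i (lp.single 2 i x i) = T i x
    rw [lp.single_apply_self]
  refine ⟨fun x hx => ?_, fun x => ?_⟩
  · have := (hdom _ (hmem ⟨x, hx⟩)).fst i
    rwa [hTx] at this
  · have h1 := hle ⟨_, hmem x⟩
    rw [lp.norm_single (by norm_num)] at h1
    refine le_trans ?_ h1
    refine le_trans (le_of_eq ?_) (lp.norm_apply_le_norm (by norm_num) _ i)
    rw [lp.coeFn_sub, Pi.sub_apply]
    congr 2
    · exact LinearPMap_congr _ (hTx x).symm _ _
    · change T i (D i x) = T i (D i ⟨lp.single 2 i (x : E i) i, hcomp x i⟩)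
      rw [happ, lp.single_apply_self]

theorem commutatorNormLE_directSum {D : ∀ i, E i →ₗ.[ℂ] E i} {T : ∀ i, E i →L[ℂ] E i} {C : ℝ}
    {hC : 0 ≤ C} {hT : ∀ i, ‖T i‖ ≤ C} (h : ∀ i, CommutatorNormLE (D i) (T i) 1) :
    CommutatorNormLE (directSumOperator D) (directSumBounded T C hC hT) 1 := by
  choose hdom hle using h
  have hdom' (x : lp E 2) (hx : x ∈ (directSumOperator D).domain) :
      directSumBounded T C hC hT x ∈ (directSumOperator D).domain := by
    refine ⟨fun i => hdom i _ (hx.fst i), ?_⟩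
    -- Square summability of `D T x` comes from `D T x = [D, T] x + T D x`: the first term is
    -- bounded by `x` componentwise, and `T` is uniformly bounded.
    have h1 : Memℓp (fun i => D i ⟨T i (x i), hdom i _ (hx.fst i)⟩ -
        T i (D i ⟨x i, hx.fst i⟩)) 2 :=
      (lp.memℓp x).mono' fun i => by simpa using hle i ⟨x i, hx.fst i⟩
    have h2 : Memℓp (fun i => T i (D i ⟨x i, hx.fst i⟩)) 2 :=
      memLp_directSum T hT (directSumOperator D ⟨x, hx⟩)
    have h3 := h1.add h2
    refine h3.mono' fun i => le_of_eq ?_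
    rw [Pi.add_apply, sub_add_cancel]
    rfl
  refine ⟨hdom', fun x => ?_⟩
  rw [one_mul]
  refine lp.norm_mono (by norm_num) fun i => ?_
  have hi := hle i ⟨(x : lp E 2) i, x.2.fst i⟩
  rw [one_mul] at hi
  exact hi

end DirectSumCommutator

/-! ### The commutator with a multiplication operator on the circle -/

section Circle

variable {T : ℝ} [hT : Fact (0 < T)]

/-- The circle rotated by `t`. -/
def rotate (T : ℝ) (t : ℝ) : C(AddCircle T, AddCircle T) :=
  ⟨fun x => x + (t : AddCircle T), by fun_prop⟩

theorem measurePreserving_rotate (t : ℝ) :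
    MeasurePreserving (rotate T t) AddCircle.haarAddCircle AddCircle.haarAddCircle :=
  measurePreserving_add_right _ _

/-- Translation of functions on the circle. -/
def translation (t : ℝ) : CircleL2 T →ₗᵢ[ℂ] CircleL2 T :=
  Lp.compMeasurePreservingₗᵢ ℂ (rotate T t) (measurePreserving_rotate t)

theorem coeFn_translation (t : ℝ) (ξ : CircleL2 T) :
    translation t ξ =ᵐ[AddCircle.haarAddCircle] ξ ∘ rotate T t :=
  Lp.coeFn_compMeasurePreserving ξ (measurePreserving_rotate t)

theorem coeFn_multiplication (g : C(AddCircle T, ℂ)) (ξ : CircleL2 T) :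
    multiplication g ξ =ᵐ[AddCircle.haarAddCircle] fun x => g x * ξ x := by
  have h1 : multiplication g ξ =ᵐ[AddCircle.haarAddCircle] _ :=
    Lp.coeFn_lpSMul (ContinuousMap.toLp ∞ AddCircle.haarAddCircle ℂ g) ξ
  filter_upwards [h1, ContinuousMap.coeFn_toLp (p := ∞) (𝕜 := ℂ) AddCircle.haarAddCircle g]
    with x h1 h2
  rw [h1, Pi.smul_apply', h2, smul_eq_mul]

theorem repr_translation (t : ℝ) (ξ : CircleL2 T) (k : ℤ) :
    fourierBasis.repr (translation t ξ) k =
      fourier k (t : AddCircle T) * fourierBasis.repr ξ k := by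
  rw [fourierBasis_repr, fourierBasis_repr, fourierCoeff_congr_ae (coeFn_translation t ξ)]
  unfold fourierCoeff
  rw [← integral_const_mul]
  conv_rhs => rw [← integral_add_right_eq_self _ (t : AddCircle T)]
  refine integral_congr_ae (Filter.Eventually.of_forall fun x => ?_)
  have hk : fourier k (t : AddCircle T) * fourier (-k) (x + (t : AddCircle T)) =
      fourier (-k) x := by
    have h1 : fourier (-k) (x + (t : AddCircle T)) =
        fourier (-k) x * fourier (-k) (t : AddCircle T) := by
      simp [fourier_apply, smul_add, AddCircle.toCircle_add]
    have h2 : fourier k (t : AddCircle T) * fourier (-k) (t : AddCircle T) = 1 := by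
      rw [← fourier_add, add_neg_cancel, fourier_zero]
    rw [h1, mul_left_comm, h2, mul_one]
  simp only [smul_eq_mul, Function.comp_apply]
  rw [← mul_assoc, hk]
  rfl

theorem multiplication_translation (g : C(AddCircle T, ℂ)) (t : ℝ) (ξ : CircleL2 T) :
    multiplication g (translation t ξ) - translation t (multiplication g ξ) =
      multiplication (g - g.comp (rotate T t)) (translation t ξ) := by
  refine Lp.ext ?_
  have hq := (measurePreserving_rotate (T := T) t).quasiMeasurePreserving
  filter_upwards [Lp.coeFn_sub (multiplication g (translation t ξ))
      (translation t (multiplication g ξ)), coeFn_multiplication g (translation t ξ),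
    coeFn_multiplication (g - g.comp (rotate T t)) (translation t ξ), coeFn_translation t ξ,
    coeFn_translation t (multiplication g ξ), hq.ae (coeFn_multiplication g ξ)]
    with x h1 h2 h3 h4 h5 h6
  rw [h1, Pi.sub_apply, h2, h3, h5, Function.comp_apply, h6, h4, Function.comp_apply,
    ContinuousMap.sub_apply, ContinuousMap.comp_apply]
  ring

theorem norm_multiplication_apply_le {g : C(AddCircle T, ℂ)} {C : ℝ} (hC : 0 ≤ C)
    (hg : ∀ x, ‖g x‖ ≤ C) (ξ : CircleL2 T) : ‖multiplication g ξ‖ ≤ C * ‖ξ‖ :=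
  (multiplication g).le_of_opNorm_le
    ((norm_multiplication_le g).trans ((ContinuousMap.norm_le g hC).2 hg)) ξ

theorem norm_sq_toLp (f : C(AddCircle T, ℂ)) :
    ‖(ContinuousMap.toLp 2 AddCircle.haarAddCircle ℂ f : CircleL2 T)‖ ^ 2 =
      ∫ x, ‖f x‖ ^ 2 ∂AddCircle.haarAddCircle := by
  have h := ContinuousMap.inner_toLp (𝕜 := ℂ) (AddCircle.haarAddCircle (T := T)) f f
  rw [inner_self_eq_norm_sq_to_K] at h
  have h2 : (∫ x, f x * (starRingEnd ℂ) (f x) ∂AddCircle.haarAddCircle) =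
      ((∫ x, ‖f x‖ ^ 2 ∂AddCircle.haarAddCircle : ℝ) : ℂ) := by
    rw [← integral_complex_ofReal]
    refine integral_congr_ae (Filter.Eventually.of_forall fun x => ?_)
    simp [Complex.mul_conj']
  rw [h2] at h
  refine Complex.ofReal_injective ?_
  rw [Complex.ofReal_pow]
  exact h

theorem norm_apply_le_of_norm_multiplication_le {g : C(AddCircle T, ℂ)} {C : ℝ} (hC : 0 ≤ C)
    (hg : ∀ ξ : CircleL2 T, ‖multiplication g ξ‖ ≤ C * ‖ξ‖) (x : AddCircle T) : ‖g x‖ ≤ C := by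
  -- This test function lives where `‖g‖ > C`. There `‖g φ‖² - C² ‖φ‖²` is positive, but its
  -- integral is at most 0; by continuity it vanishes everywhere, so that set is empty.
  let φ : C(AddCircle T, ℂ) := ⟨fun x => ((max 0 (‖g x‖ - C) : ℝ) : ℂ), by fun_prop⟩
  have hφ (x : AddCircle T) : ‖φ x‖ = max 0 (‖g x‖ - C) := by
    change ‖((max 0 (‖g x‖ - C) : ℝ) : ℂ)‖ = _
    rw [Complex.norm_real, Real.norm_of_nonneg (le_max_left _ _)]
  have hmul : multiplication g (ContinuousMap.toLp 2 AddCircle.haarAddCircle ℂ φ) =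
      ContinuousMap.toLp 2 AddCircle.haarAddCircle ℂ (g * φ) := by
    refine Lp.ext ?_
    filter_upwards [coeFn_multiplication g (ContinuousMap.toLp 2 AddCircle.haarAddCircle ℂ φ),
      ContinuousMap.coeFn_toLp (p := 2) (𝕜 := ℂ) AddCircle.haarAddCircle φ,
      ContinuousMap.coeFn_toLp (p := 2) (𝕜 := ℂ) AddCircle.haarAddCircle (g * φ)] with x h1 h2 h3
    rw [h1, h2, h3, ContinuousMap.mul_apply]
  have hle := hg (ContinuousMap.toLp 2 AddCircle.haarAddCircle ℂ φ)
  have hsq := pow_le_pow_left₀ (norm_nonneg _) hle 2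
  rw [hmul, mul_pow, norm_sq_toLp, norm_sq_toLp, ← integral_const_mul, ← sub_nonpos] at hsq
  have hint (f : AddCircle T → ℝ) (hf : Continuous f) :
      Integrable f (AddCircle.haarAddCircle (T := T)) :=
    hf.integrable_of_hasCompactSupport (HasCompactSupport.of_compactSpace f)
  rw [← integral_sub (hint _ (by fun_prop)) (hint _ (by fun_prop))] at hsq
  set F : AddCircle T → ℝ := fun x => ‖(g * φ) x‖ ^ 2 - C ^ 2 * ‖φ x‖ ^ 2 with hF
  have hFcont : Continuous F := by fun_prop
  have hFeq (x : AddCircle T) : F x = (‖g x‖ ^ 2 - C ^ 2) * max 0 (‖g x‖ - C) ^ 2 := by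
    simp only [hF, ContinuousMap.mul_apply, norm_mul, hφ]
    ring
  have hFnonneg : 0 ≤ F := fun x => by
    rw [hFeq]
    rcases le_total (‖g x‖) C with h | h
    · rw [max_eq_left (by linarith)]
      simp
    · exact mul_nonneg (by nlinarith) (sq_nonneg _)
  have h0 := (integral_eq_zero_iff_of_nonneg hFnonneg (hint F hFcont)).1
    (le_antisymm hsq (integral_nonneg hFnonneg))
  have hFzero := (hFcont.ae_eq_iff_eq _ continuous_zero).1 h0
  by_contra! hx
  have hxF := congrFun hFzero x
  rw [hFeq, max_eq_right (by linarith)] at hxF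
  have : 0 < (‖g x‖ ^ 2 - C ^ 2) * (‖g x‖ - C) ^ 2 :=
    mul_pos (by nlinarith) (pow_pos (by linarith) 2)
  exact this.ne' hxF

/-- The unitary group generated by `circleDirac n`. -/
def circleGroup (n : ℕ) (t : ℝ) : CircleL2 (perimeter n) →ₗᵢ[ℂ] CircleL2 (perimeter n) where
  toLinearMap := Complex.exp (Complex.I * (t * (1 / (2 * radius n)) : ℝ)) •
    (translation t).toLinearMap
  norm_map' ξ := by
    rw [LinearMap.smul_apply, norm_smul, mul_comm Complex.I, Complex.norm_exp_ofReal_mul_I, one_mul]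
    exact (translation t).norm_map ξ

theorem circleGroup_apply (n : ℕ) (t : ℝ) (ξ : CircleL2 (perimeter n)) :
    circleGroup n t ξ = Complex.exp (Complex.I * (t * (1 / (2 * radius n)) : ℝ)) •
      translation t ξ := rfl

/-- As the perimeter is `2π` times the radius, translation by `t` multiplies the `k`-th Fourier
coefficient by `exp (i t k / radius n)`; the scalar phase supplies the shift `1 / (2 * radius n)`.
-/
theorem isUnitaryGroup_circleGroup (n : ℕ) :
    IsUnitaryGroup fourierBasis (fun k : ℤ => k / radius n + 1 / (2 * radius n))
      (circleGroup n) := by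
  intro t ξ k
  have hr : (radius n : ℂ) ≠ 0 := Complex.ofReal_ne_zero.2 (radius_pos n).ne'
  have hpi : (Real.pi : ℂ) ≠ 0 := Complex.ofReal_ne_zero.2 Real.pi_ne_zero
  rw [circleGroup_apply, map_smul, lp.coeFn_smul, Pi.smul_apply, repr_translation, smul_eq_mul,
    ← mul_assoc, fourier_coe_apply, ← Complex.exp_add]
  congr 2
  rw [perimeter]
  push_cast
  field_simp
  ring

theorem multiplication_circleGroup (n : ℕ) (g : C(AddCircle (perimeter n), ℂ)) (t : ℝ)
    (ξ : CircleL2 (perimeter n)) :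
    multiplication g (circleGroup n t ξ) - circleGroup n t (multiplication g ξ) =
      multiplication (g - g.comp (rotate (perimeter n) t)) (circleGroup n t ξ) := by
  rw [circleGroup_apply, circleGroup_apply, map_smul, map_smul, ← smul_sub,
    multiplication_translation]

theorem norm_sub_le_of_commutatorNormLE {n : ℕ} {g : C(AddCircle (perimeter n), ℂ)}
    (hg : CommutatorNormLE (circleDirac n) (multiplication g) 1) (t : ℝ)
    (x : AddCircle (perimeter n)) : ‖g x - g (x + (t : AddCircle (perimeter n)))‖ ≤ |t| := by
  have hU := isUnitaryGroup_circleGroup n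
  refine norm_apply_le_of_norm_multiplication_le (g := g - g.comp (rotate (perimeter n) t))
    (abs_nonneg t) (fun ξ => ?_) x
  -- The argument `circleGroup n (-t) ξ` cancels the unitary factor, which leaves a pure
  -- multiplication operator.
  have h := hU.norm_commutator_le hg t (circleGroup n (-t) ξ)
  rwa [multiplication_circleGroup, ← hU.add, add_neg_cancel, hU.zero,
    (circleGroup n (-t)).norm_map] at h

theorem commutatorNormLE_of_norm_sub_le {n : ℕ} {g : C(AddCircle (perimeter n), ℂ)} {δ : ℝ}
    (hδ : 0 < δ) (hg : ∀ t, 0 < t → t < δ → ∀ x : AddCircle (perimeter n),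
      ‖g x - g (x + (t : AddCircle (perimeter n)))‖ ≤ t) :
    CommutatorNormLE (circleDirac n) (multiplication g) 1 := by
  refine (isUnitaryGroup_circleGroup n).commutatorNormLE hδ fun t h0 h1 ξ => ?_
  rw [norm_sub_rev, multiplication_circleGroup]
  refine (norm_multiplication_apply_le h0.le (hg t h0 h1) _).trans_eq ?_
  rw [(circleGroup n t).norm_map]

end Circle

/-! ### The spectral distance -/

theorem commutatorNormLE_gasket_iff {f : C(gasket, ℂ)} :
    CommutatorNormLE gasketDirac (gasketRep f) 1 ↔
      ∀ w : List (Fin 3),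
        CommutatorNormLE (circleDirac w.length) (multiplication (f.comp (loop w))) 1 :=
  ⟨fun h w => commutatorNormLE_of_directSum h w, fun h => commutatorNormLE_directSum h⟩

/-! ### Arclength parameterization and Lipschitz bounds along a triangle. -/

theorem perimeter_eq (n : ℕ) : perimeter n = 3 * side n := by unfold side; ring

theorem coe_loop (w : List (Fin 3)) {t : ℝ} (ht : t ∈ Icc 0 (perimeter w.length)) :
    (loop w (t : AddCircle (perimeter w.length)) : Plane) = turn w t := by
  change AddCircle.liftIco (perimeter w.length) 0 (turn w) t = turn w t
  rcases ht.2.eq_or_lt with h | h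
  · rw [h, AddCircle.coe_period, ← turn_zero_eq, ← AddCircle.coe_zero,
      AddCircle.liftIco_zero_coe_apply ⟨le_rfl, perimeter_pos _⟩]
  · exact AddCircle.liftIco_zero_coe_apply ⟨ht.1, h⟩

/-- One formula replaces the three branches and includes both endpoints of each side. In `vertex w
(k + 1)` the addition is modulo 3, whereas in the interval it is real. -/
theorem turn_eq_lineMap (w : List (Fin 3)) (k : Fin 3) {t : ℝ}
    (ht : t ∈ Icc (k * side w.length) ((k + 1) * side w.length)) :
    turn w t = AffineMap.lineMap (vertex w k) (vertex w (k + 1)) (t / side w.length - k) := by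
  have hs := side_pos w.length
  obtain ⟨h0, h1⟩ := ht
  unfold turn
  fin_cases k
  · norm_num at h0 h1 ⊢
    intro h
    linarith
  · norm_num at h0 h1 ⊢
    rcases h0.eq_or_lt with h | h
    · rw [if_pos h.ge, ← h, div_self hs.ne']
      simp
    · rw [if_neg h.not_ge, if_pos h1]
      rfl
  · norm_num at h0 h1 ⊢
    rw [if_neg (by linarith)]
    rcases h0.eq_or_lt with h | h
    · rw [if_pos h.ge, ← h, mul_div_assoc, div_self hs.ne']
      norm_num
      rfl
    · rw [if_neg h.not_ge]
      rfl

theorem loop_mul_side (w : List (Fin 3)) (k : Fin 3) :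
    loop w ((k * side w.length : ℝ) : AddCircle (perimeter w.length)) =
      ⟨vertex w k, vertex_mem_gasket w k⟩ := by
  have hs := side_pos w.length
  have hk : (k : ℝ) ≤ 2 := by exact_mod_cast Nat.le_of_lt_succ k.2
  refine Subtype.ext ?_
  rw [coe_loop w ⟨by positivity, by rw [perimeter_eq]; nlinarith⟩,
    turn_eq_lineMap w k ⟨le_rfl, by nlinarith⟩, mul_div_assoc, div_self hs.ne', mul_one, sub_self,
    AffineMap.lineMap_apply_zero]

theorem dist_vertex_le_of_commutatorNormLE {f : C(gasket, ℂ)}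
    (hf : CommutatorNormLE gasketDirac (gasketRep f) 1) (w : List (Fin 3)) (i j : Fin 3) :
    dist (f ⟨vertex w i, vertex_mem_gasket w i⟩) (f ⟨vertex w j, vertex_mem_gasket w j⟩) ≤
      side w.length := by
  have hs := side_pos w.length
  have hstep (s t : ℝ) (h : t = s + side w.length) :
      dist (f (loop w (s : AddCircle (perimeter w.length))))
        (f (loop w (t : AddCircle (perimeter w.length)))) ≤ side w.length := by
    have := norm_sub_le_of_commutatorNormLE (commutatorNormLE_gasket_iff.1 hf w) (side w.length)
      (s : AddCircle (perimeter w.length))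
    rwa [abs_of_pos hs, ← AddCircle.coe_add, ← h, ContinuousMap.comp_apply,
      ContinuousMap.comp_apply, ← dist_eq_norm] at this
  -- The third side ends at parameter `3 * side`, a full period, hence at vertex 0.
  have hperiod : loop w ((0 : ℝ) : AddCircle (perimeter w.length)) =
      loop w ((3 * side w.length : ℝ) : AddCircle (perimeter w.length)) := by
    rw [← perimeter_eq, AddCircle.coe_period, AddCircle.coe_zero]
  have h01 := hstep ((0 : Fin 3) * side w.length) ((1 : Fin 3) * side w.length) (by norm_num)
  have h12 := hstep ((1 : Fin 3) * side w.length) ((2 : Fin 3) * side w.length)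
    (by norm_num; ring)
  have h20 := hstep ((2 : Fin 3) * side w.length) (3 * side w.length) (by norm_num; ring)
  have e0 := loop_mul_side w 0
  rw [loop_mul_side, loop_mul_side] at h01 h12
  rw [← hperiod, loop_mul_side] at h20
  norm_num at e0
  rw [AddCircle.coe_zero, e0] at h20
  fin_cases i <;> fin_cases j <;> first
    | exact (dist_self _).trans_le hs.le
    | assumption
    | (rw [dist_comm]; assumption)

theorem abs_sub_le_of_Icc {φ : ℝ → ℝ} {a b c : ℝ}
    (h1 : ∀ s ∈ Icc a b, ∀ t ∈ Icc a b, |φ s - φ t| ≤ |s - t|)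
    (h2 : ∀ s ∈ Icc b c, ∀ t ∈ Icc b c, |φ s - φ t| ≤ |s - t|) :
    ∀ s ∈ Icc a c, ∀ t ∈ Icc a c, |φ s - φ t| ≤ |s - t| := by
  intro s hs t ht
  wlog hst : s ≤ t generalizing s t
  · rw [abs_sub_comm, abs_sub_comm s]
    exact this t ht s hs (le_of_not_ge hst)
  rcases le_total t b with htb | htb
  · exact h1 s ⟨hs.1, hst.trans htb⟩ t ⟨ht.1, htb⟩
  rcases le_total s b with hsb | hsb
  · have i1 := h1 s ⟨hs.1, hsb⟩ b ⟨hs.1.trans hsb, le_rfl⟩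
    have i2 := h2 b ⟨le_rfl, htb.trans ht.2⟩ t ⟨htb, ht.2⟩
    rw [abs_of_nonpos (by linarith : s - b ≤ 0)] at i1
    rw [abs_of_nonpos (by linarith : b - t ≤ 0)] at i2
    rw [abs_of_nonpos (by linarith : s - t ≤ 0)]
    linarith [abs_sub_le (φ s) (φ b) (φ t)]
  · exact h2 s ⟨hsb, hs.2⟩ t ⟨htb, ht.2⟩

/-- The geodesic distance from `p`, as a complex-valued continuous function on the gasket. -/
def distanceFrom (p : gasket) : C(gasket, ℂ) :=
  ⟨fun x => ((geodesicDist p x).toReal : ℂ),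
    Complex.continuous_ofReal.comp (continuous_geodesicDist p)⟩

theorem norm_distanceFrom_sub (p x y : gasket) :
    ‖distanceFrom p x - distanceFrom p y‖ =
      |(geodesicDist p x).toReal - (geodesicDist p y).toReal| := by
  change ‖((geodesicDist p x).toReal : ℂ) - ((geodesicDist p y).toReal : ℂ)‖ = _
  rw [← Complex.ofReal_sub, Complex.norm_real, Real.norm_eq_abs]

/-- On a single side, the segment between two points is a curve in the gasket of length `|s - t|`;
the three sides are then glued by `abs_sub_le_of_Icc`. -/
theorem abs_geodesicDist_loop_sub_le (p : gasket) (w : List (Fin 3)) :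
    ∀ s ∈ Icc 0 (perimeter w.length), ∀ t ∈ Icc 0 (perimeter w.length),
      |(geodesicDist p (loop w s)).toReal - (geodesicDist p (loop w t)).toReal| ≤ |s - t| := by
  have hs := side_pos w.length
  have hpiece (k : Fin 3) : ∀ s ∈ Icc (k * side w.length) ((k + 1) * side w.length),
      ∀ t ∈ Icc (k * side w.length) ((k + 1) * side w.length),
      |(geodesicDist p (loop w s)).toReal - (geodesicDist p (loop w t)).toReal| ≤ |s - t| := by
    have hk : (k : ℝ) ≤ 2 := by exact_mod_cast Nat.le_of_lt_succ k.2
    have hcoe (t : ℝ) (ht : t ∈ Icc (k * side w.length) ((k + 1) * side w.length)) :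
        (loop w (t : AddCircle (perimeter w.length)) : Plane) =
          AffineMap.lineMap (vertex w k) (vertex w (k + 1)) (t / side w.length - k) := by
      rw [coe_loop w ⟨le_trans (by positivity) ht.1, ht.2.trans (by rw [perimeter_eq]; nlinarith)⟩,
        turn_eq_lineMap w k ht]
    have hmem (t : ℝ) (ht : t ∈ Icc (k * side w.length) ((k + 1) * side w.length)) :
        (loop w (t : AddCircle (perimeter w.length)) : Plane) ∈
          segment ℝ (vertex w k) (vertex w (k + 1)) := by
      rw [hcoe t ht, segment_eq_image_lineMap]
      refine mem_image_of_mem _ ⟨?_, ?_⟩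
      · rw [sub_nonneg, le_div_iff₀ hs]
        exact ht.1
      · rw [sub_le_iff_le_add', div_le_iff₀ hs]
        exact ht.2
    intro s hss t htt
    refine (abs_geodesicDist_sub_le p _ _).trans ?_
    refine ENNReal.toReal_le_of_le_ofReal (abs_nonneg _) ?_
    refine (geodesicDist_le_edist (((convex_segment _ _).segment_subset (hmem s hss)
      (hmem t htt)).trans (segment_vertex_subset w k (k + 1)))).trans ?_
    rw [edist_dist, Subtype.dist_eq, hcoe s hss, hcoe t htt, dist_lineMap_lineMap,
      dist_vertex w (by fin_cases k <;> decide)]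
    refine ENNReal.ofReal_le_ofReal (le_of_eq ?_)
    rw [Real.dist_eq, sub_sub_sub_cancel_right, ← sub_div, abs_div, abs_of_pos hs,
      div_mul_cancel₀ _ hs.ne']
  have h0 := hpiece 0
  have h1 := hpiece 1
  have h2 := hpiece 2
  norm_num at h0 h1 h2
  intro s hs t ht
  rw [perimeter_eq] at hs ht
  exact abs_sub_le_of_Icc (φ := fun t => (geodesicDist p (loop w t)).toReal)
    (fun s hs t ht => h0 s hs.1 hs.2 t ht.1 ht.2)
    (abs_sub_le_of_Icc (fun s hs t ht => h1 s hs.1 hs.2 t ht.1 ht.2)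
      fun s hs t ht => h2 s hs.1 hs.2 t ht.1 ht.2) s hs t ht

theorem commutatorNormLE_distanceFrom (p : gasket) :
    CommutatorNormLE gasketDirac (gasketRep (distanceFrom p)) 1 := by
  refine commutatorNormLE_gasket_iff.2 fun w =>
    commutatorNormLE_of_norm_sub_le (perimeter_pos w.length) fun t h0 h1 x => ?_
  have hlip := abs_geodesicDist_loop_sub_le p w
  have hP := perimeter_pos w.length
  obtain ⟨s, hs, rfl⟩ : ∃ s ∈ Ico 0 (perimeter w.length), (s : AddCircle _) = x := by
    have := AddCircle.coe_image_Ico_eq (perimeter w.length) 0 ▸ mem_univ x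
    simpa using this
  rw [ContinuousMap.comp_apply, ContinuousMap.comp_apply, norm_distanceFrom_sub,
    ← AddCircle.coe_add]
  rcases le_total (s + t) (perimeter w.length) with h | h
  · refine (hlip s ⟨hs.1, hs.2.le⟩ (s + t) ⟨by linarith [hs.1], h⟩).trans_eq ?_
    rw [sub_add_cancel_left, abs_neg, abs_of_pos h0]
  -- The arc passes the base point. It is split there, and its two parts have total length `t`.
  · have e1 : ((s + t : ℝ) : AddCircle (perimeter w.length)) =
        ((s + t - perimeter w.length : ℝ) : AddCircle (perimeter w.length)) := by
      rw [AddCircle.coe_sub, AddCircle.coe_period, sub_zero]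
    have i1 := hlip s ⟨hs.1, hs.2.le⟩ (perimeter w.length) ⟨hP.le, le_rfl⟩
    have i2 := hlip 0 ⟨le_rfl, hP.le⟩ (s + t - perimeter w.length)
      ⟨by linarith, by linarith [hs.2]⟩
    rw [AddCircle.coe_period, ← AddCircle.coe_zero,
      abs_of_nonpos (by linarith [hs.2] : s - perimeter w.length ≤ 0)] at i1
    rw [abs_of_nonpos (by linarith : 0 - (s + t - perimeter w.length) ≤ 0)] at i2
    rw [e1]
    have := abs_sub_le (geodesicDist p (loop w s)).toReal
      (geodesicDist p (loop w ((0 : ℝ) : AddCircle (perimeter w.length)))).toReal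
      (geodesicDist p (loop w ((s + t - perimeter w.length : ℝ) :
        AddCircle (perimeter w.length)))).toReal
    linarith

/-! ### The two inequalities between the distances. -/

theorem spectralDist_le_geodesicDist (p q : gasket) : spectralDist p q ≤ geodesicDist p q := by
  refine iSup₂_le fun f hf => le_iInf₂ fun γ _ => ?_
  rw [← edist_eq_enorm_sub]
  exact edist_le_eVariationOn (dist_vertex_le_of_commutatorNormLE hf) γ

theorem geodesicDist_le_spectralDist (p q : gasket) : geodesicDist p q ≤ spectralDist p q := by
  refine le_trans (le_of_eq ?_)
    (le_iSup₂_of_le (distanceFrom p) (commutatorNormLE_distanceFrom p) le_rfl)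
  rw [← ofReal_norm, norm_distanceFrom_sub, geodesicDist_self, ENNReal.toReal_zero,
    zero_sub, abs_neg, abs_of_nonneg ENNReal.toReal_nonneg,
    ENNReal.ofReal_toReal (geodesicDist_ne_top p q)]

end SierpinskiGasket

end

theorem theorem8p13 (p q : SierpinskiGasket.gasket) :
    SierpinskiGasket.geodesicDist p q ≠ ⊤ ∧
      SierpinskiGasket.spectralDist p q = SierpinskiGasket.geodesicDist p q := by
  exact ⟨SierpinskiGasket.geodesicDist_ne_top p q, le_antisymm
    (SierpinskiGasket.spectralDist_le_geodesicDist p q)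
    (SierpinskiGasket.geodesicDist_le_spectralDist p q)⟩
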